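/- Fix $t\in(0,1)$. A signature is a weakly decreasing integer sequence: $\mathrm{Sig}_\infty$ is the set of sequences $(\nu_1\ge\nu_2\ge\cdots)$ in $\mathbb Z$, and $\mathrm{Sig}_{2\infty}$ is the set of $(\mu_i)_{i\in\mathbb Z}\in\mathbb Z^{\mathbb Z}$ with $\mu_{i+1}\le\mu_i$ for all $i$, both with the product $\sigma$-algebra. For $d\in\mathbb Z$ let $F_d$ replace each coordinate $x$ by $\min(d,x)$. Reflecting walkers. Given walkers at weakly decreasing positions with a first (top) walker, each walker having a clock, the rule is: when the clock of walker $i$ rings, walker $i-e$ moves up by $1$, where $e\ge 0$ is smallest such that the positions are weakly decreasing after the move. For $\nu\in\mathrm{Sig}_\infty$ let $\mathcal S^{\nu,\infty}(T)$, $T\ge0$, be the process started at $\nu$ that follows this rule, where the clocks of the walkers $i=1,2,\dots$ are independent and the waiting times of clock $i$ are i.i.d. exponential of rate $t^i$ (almost surely only finitely many rings occur up to any time). Let $(c_i)_{i\in\mathbb Z}$ be independent clocks, where $c_i$ has i.i.d. exponential waiting times of rate $t^i$. For $\mu\in\mathrm{Sig}_{2\infty}$ and $n\ge 0$ let $X^{n}(T)=(X^{n}_i(T))_{i\ge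 -n}$ be the walkers with indices $-n,-n+1,\dots$, started at $(\mu_{-n},\mu_{-n+1},\dots)$, which follow the same rule with the clocks $c_{-n},c_{-n+1},\dots$; these systems for different $n$ are thus coupled by the common clocks. **Theorem.** For every $\mu\in\mathrm{Sig}_{2\infty}$ there is a process $\mathcal S^{\mu,2\infty}(T)$, $T\in\mathbb R_{\ge0}$, with values in $\mathrm{Sig}_{2\infty}$, defined on the probability space of the clocks, such that: 1. almost surely, for all $T\ge 0$ and $i\in\mathbb Z$, the sequence $(X^{n}_i(T))_{n\ge \max(0,-i)}$ is weakly decreasing in $n$ and converges to $\mathcal S^{\mu,2\infty}_i(T)$; 2. $\mathcal S^{\mu,2\infty}(0)=\mu$; 3. $\mathcal S^{\mu,2\infty}$ is a (time-homogeneous) Markov process; 4. for every $d\in\mathbb Z$, the process $F_d(\mathcal S^{\mu,2\infty}(T))$ is a (time-homogeneous) Markov process; 5. if $d,k\in\mathbb Z$ and $\mu_k\ge d$, then almost surely $\min(d,\mathcal S^{\mu,2\infty}_i(T))=d$ for all $i\le k$ and $T\ge0$, and the process $\big(\min(d,\mathcal S^{\mu,2\infty}_{k+i}(T))\big)_{i\ge1}$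 in $T\ge 0$ has the same finite-dimensional (multi-time) distributions as $F_d\big(\mathcal S^{(\mu_{k+1},\mu_{k+2},\dots),\infty}(t^kT)\big)$. -/

import Mathlib

open MeasureTheory ProbabilityTheory Filter Topology
open scoped NNReal

noncomputable section

namespace PoissonSea

/-- Weakly decreasing integer sequences with a first part. The element `ν` stands for the signature
`(ν 0, ν 1, ν 2, …)`, i.e. the walker with (1-based) number `i + 1` is at position `ν i`. -/
abbrev HalfSig : Type := {ν : ℕ → ℤ // Antitone ν}

/-- Bi-infinite weakly decreasing integer sequences. -/
abbrev BiSig : Type := {μ : ℤ → ℤ // Antitone μ}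

/-- The parts `(μ_a, μ_{a+1}, …)` of a bi-infinite signature. -/
def BiSig.tail (μ : BiSig) (a : ℤ) : HalfSig :=
  ⟨fun i => μ.1 (a + i), fun i j h => μ.2 (by omega)⟩

/-- Truncation `F_d` of a bi-infinite signature: `min(d, ·)` in each coordinate. -/
def BiSig.trunc (d : ℤ) (μ : BiSig) : BiSig :=
  ⟨fun i => min d (μ.1 i), fun _ _ h => min_le_min_left d (μ.2 h)⟩

/-- Truncation `F_d` of a half-infinite signature: `min(d, ·)` in each coordinate. -/
def HalfSig.trunc (d : ℤ) (ν : HalfSig) : HalfSig :=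
  ⟨fun i => min d (ν.1 i), fun _ _ h => min_le_min_left d (ν.2 h)⟩

/-! ### The half-infinite system of reflecting walkers, driven by given clocks -/

/-- The configuration in which the `j`-th walker has moved up by one. -/
def bump (x : ℕ → ℤ) (j : ℕ) : ℕ → ℤ := Function.update x j (x j + 1)

open Classical in
/-- The walker which moves when the clock of walker `i` rings: the walker `i - d` with the smallest
`d ≥ 0` such that the configuration is still weakly decreasing after the move. -/
def mover (x : ℕ → ℤ) (i : ℕ) : ℕ := Nat.findGreatest (fun j => Antitone (bump x j)) i

theorem antitone_bump_mover (x : HalfSig) (i : ℕ) : Antitone (bump x.1 (mover x.1 i)) := by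
  classical
  have h0 : Antitone (bump x.1 0) := by
    refine antitone_nat_of_succ_le fun n => ?_
    have : x.1 (n + 1) ≤ x.1 n := x.2 (Nat.le_succ n)
    rcases n with _ | n
    · simp only [bump, Function.update_self]
      rw [Function.update_of_ne (by omega)]
      rw [Nat.zero_add] at this ⊢
      omega
    · simp only [bump]
      rw [Function.update_of_ne (by omega), Function.update_of_ne (by omega)]
      exact this
  exact Nat.findGreatest_spec (P := fun j => Antitone (bump x.1 j)) (Nat.zero_le i) h0

/-- The effect of a ring of the clock of walker `i`. -/
def afterRing (x : HalfSig) (i : ℕ) : HalfSig := ⟨bump x.1 (mover x.1 i), antitone_bump_mover x i⟩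

/-- The time of the `m`-th ring (`m = 0, 1, …`) of a clock with successive waiting times `w`. -/
def ringTime (w : ℕ → ℝ) (m : ℕ) : ℝ := ∑ l ∈ Finset.range (m + 1), w l

/-- All rings up to time `T`, as pairs (time, number of the walker), where `a i` is the sequence of
waiting times of the clock of walker `i`. -/
def rings (a : ℕ → ℕ → ℝ) (T : ℝ) : Set (ℝ ×ₗ ℕ) :=
  {p | (ofLex p).1 ≤ T ∧ ∃ m, (ofLex p).1 = ringTime (a (ofLex p).2) m}

open Classical in
/-- The configuration at time `T` of the half-infinite walker system which starts from `ν` and whose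
clocks have the waiting times `a`: the finitely many rings up to time `T` are carried out in
chronological order. (Infinitely many rings up to time `T`, simultaneous rings, and waiting times
that are not positive occur with probability zero below, and the value is irrelevant there.) -/
def walkers (ν : HalfSig) (a : ℕ → ℕ → ℝ) (T : ℝ) : HalfSig :=
  if h : (rings a T).Finite then
    ((h.toFinset.sort (· ≤ ·)).map fun p => (ofLex p).2).foldl afterRing ν
  else ν

/-! ### Random clocks -/

instance (r : Set.Ioi (0 : ℝ)) : IsProbabilityMeasure (expMeasure (r : ℝ)) :=
  isProbabilityMeasure_expMeasure r.2

/-- The law of independent clocks indexed by `ι`, where all waiting times of clock `i` are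
exponential of rate `r i`. -/
def clockLaw {ι : Type} (r : ι → Set.Ioi (0 : ℝ)) : Measure (ι → ℕ → ℝ) :=
  Measure.infinitePi fun i => Measure.infinitePi fun _ : ℕ => expMeasure (r i : ℝ)

/-- Independent clocks for the walkers `1, 2, 3, …`, with rates `t, t ^ 2, t ^ 3, …`. Under this
measure `fun a => walkers ν a T` is the process `S^{ν,∞}(T)`. -/
def halfClockLaw (t : ℝ) (ht : 0 < t) : Measure (ℕ → ℕ → ℝ) :=
  clockLaw fun i => ⟨t ^ (i + 1), pow_pos ht (i + 1)⟩

/-- Independent clocks indexed by `ℤ`, where clock `i` has rate `t ^ i`. -/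
def biClockLaw (t : ℝ) (ht : 0 < t) : Measure (ℤ → ℕ → ℝ) :=
  clockLaw fun i => ⟨t ^ i, zpow_pos ht i⟩

/-- The position at time `T` of walker `i` in the half-infinite system of the walkers
`-n, -n + 1, …`, which start at `μ_{-n}, μ_{-n+1}, …` and use the clocks `-n, -n + 1, …` of the common
family `ω`. Only meaningful for `i ≥ -n`. -/
def approx (μ : BiSig) (n : ℕ) (ω : ℤ → ℕ → ℝ) (T : ℝ) (i : ℤ) : ℤ :=
  (walkers (μ.tail (-n)) (fun j => ω (-n + j)) T).1 (i + n).toNat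

/-! ### Markov processes in continuous time -/

/-- A semigroup of Markov transition kernels. -/
structure IsTransitionSemigroup {E : Type} [MeasurableSpace E] (κ : ℝ≥0 → Kernel E E) : Prop where
  isMarkovKernel : ∀ s, IsMarkovKernel (κ s)
  zero : κ 0 = Kernel.id
  add : ∀ s u, κ (s + u) = κ u ∘ₖ κ s

/-- The information contained in `X` up to time `s`. -/
abbrev past {Ω E : Type} [MeasurableSpace E] (X : ℝ≥0 → Ω → E) (s : ℝ≥0) : MeasurableSpace Ω :=
  ⨆ r : ℝ≥0, ⨆ _ : r ≤ s, MeasurableSpace.comap (X r) inferInstance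

/-- `X` is a (time-homogeneous) Markov process under `P`, with respect to its own filtration:
the conditional law of `X (s + u)` given the past up to time `s` is `κ u (X s)`, for some transition
semigroup `κ`. -/
def IsMarkovProcess {Ω E : Type} [MeasurableSpace Ω] [MeasurableSpace E] (P : Measure Ω)
    (X : ℝ≥0 → Ω → E) : Prop :=
  (∀ s, Measurable (X s)) ∧ ∃ κ : ℝ≥0 → Kernel E E, IsTransitionSemigroup κ ∧
    ∀ s u : ℝ≥0, ∀ A : Set E, MeasurableSet A →
      P⟦X (s + u) ⁻¹' A | past X s⟧ =ᵐ[P] fun ω => (κ u (X s ω)).real A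

end PoissonSea

end

open PoissonSea

noncomputable section

namespace PoissonSea

/-! ### The effect of a single ring -/

/-! A ring of clock `i` moves the top walker of the block of walkers at the position of walker `i`.
This local rule (`afterRing_apply`) has three consequences. Influence passes only upwards in the
ordering, from a clock to walkers of smaller or equal index. Adding walkers above can only lower the
old ones, because a push may then be passed on to a new walker (`drop_afterRing_le`). The
configuration truncated at `d` evolves autonomously, and walkers at or above `d` act on those below
only as a wall that never blocks (`trunc_drop_afterRing`). All three survive iteration over the
finitely many rings up to a given time.

By the second fact, the position of walker `i` decreases as walkers are added above it. It is an
integer bounded below by its starting value, so it is eventually constant, and the limit `sea`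
exists for every family of clocks that is `Good`. Since `t < 1`, almost every family is (`ae_good`).

For the Markov property, clocks `ω` are followed up to time `s` and then replaced by independent
fresh clocks `ω'`. By memorylessness of the exponential law, the spliced clocks have the original
law (`map_spliceAll`), while pathwise the sea driven by them is the sea driven by `ω'` started from
the sea at time `s` (`sea_spliceAll`). Any flow with these two properties yields Markov processes.
So does its image under an idempotent map `f`, if the image depends only on the image of the
starting point (`IsRestartableFlow.isMarkovProcess`). The maps `id` and `BiSig.trunc d` give the two
Markov statements.

If `d ≤ μ.1 k`, the walkers up to `k` stay at or above `d`, so below `d` the later walkers form a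
half-infinite system (`tail_trunc_sea`). Its clocks have rates `t ^ (k + 1 + j)`, which
multiplication of time by `t ^ k` turns into `t ^ (j + 1)`. -/

/-- The walkers `k, k + 1, …` of a half-infinite signature. -/
def HalfSig.drop (k : ℕ) (x : HalfSig) : HalfSig :=
  ⟨fun j => x.1 (j + k), fun _ _ h => x.2 (by omega)⟩

theorem antitone_bump_iff (x : HalfSig) (j : ℕ) :
    Antitone (bump x.1 j) ↔ j = 0 ∨ x.1 j < x.1 (j - 1) := by
  constructor
  · intro h
    by_contra! hj
    obtain ⟨h0, h1⟩ := hj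
    have h2 := h (Nat.sub_le j 1)
    rw [bump, Function.update_self, Function.update_of_ne (by omega)] at h2
    omega
  · intro h
    refine antitone_nat_of_succ_le fun n => ?_
    have h1 : x.1 (n + 1) ≤ x.1 n := x.2 n.le_succ
    simp only [bump, Function.update_apply]
    split_ifs with h2 h3 h3
    · omega
    · subst h2
      simp only [Nat.add_sub_cancel] at h
      omega
    · subst h3
      omega
    · exact h1

/-- Every walker strictly between the mover and `i`, and `i` itself if it does not move, is stuck to
its predecessor. Hence the mover is the unique top of the block of `i`. This form avoids the search
in `mover` and is the only access to the dynamics used below. -/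
theorem afterRing_apply (x : HalfSig) (i j : ℕ) :
    (afterRing x i).1 j =
      if x.1 j = x.1 i ∧ (j = 0 ∨ x.1 j < x.1 (j - 1)) then x.1 j + 1 else x.1 j := by
  classical
  have hle : mover x.1 i ≤ i := Nat.findGreatest_le i
  have hspec := (antitone_bump_iff x _).1 (antitone_bump_mover x i)
  have hgr : ∀ k, mover x.1 i < k → k ≤ i → x.1 k = x.1 (k - 1) := by
    intro k h1 h2
    have h3 := Nat.findGreatest_is_greatest (P := fun j => Antitone (bump x.1 j)) h1 h2
    rw [antitone_bump_iff] at h3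
    have h4 : x.1 k ≤ x.1 (k - 1) := x.2 (Nat.sub_le k 1)
    omega
  have heq : ∀ k, mover x.1 i ≤ k → k ≤ i → x.1 k = x.1 (mover x.1 i) := by
    intro k h1
    induction k, h1 using Nat.le_induction with
    | base => simp
    | succ k hk ih =>
      intro h2
      rw [hgr (k + 1) (by omega) h2, Nat.add_sub_cancel, ih (by omega)]
  have hi := heq i hle le_rfl
  change bump x.1 (mover x.1 i) j = _
  generalize mover x.1 i = m at *
  simp only [bump, Function.update_apply]
  by_cases hj : j = m
  · subst hj
    rw [if_pos rfl, if_pos ⟨hi.symm, hspec⟩]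
  · rw [if_neg hj, if_neg]
    rintro ⟨h1, h2⟩
    rcases lt_or_gt_of_ne hj with h | h
    · have h3 : x.1 (m - 1) ≤ x.1 j := x.2 (by omega)
      omega
    · have h3 : x.1 (j - 1) ≤ x.1 m := x.2 (by omega)
      omega

theorem le_afterRing (x : HalfSig) (i : ℕ) : x ≤ afterRing x i := by
  intro j
  change x.1 j ≤ (afterRing x i).1 j
  rw [afterRing_apply]
  split_ifs <;> omega

theorem drop_afterRing_of_lt (x : HalfSig) {i k : ℕ} (h : i < k) :
    (afterRing x i).drop k = x.drop k := by
  refine Subtype.ext (funext fun j => ?_)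
  change (afterRing x i).1 (j + k) = x.1 (j + k)
  rw [afterRing_apply, if_neg]
  have : x.1 (j + k - 1) ≤ x.1 i := x.2 (by omega)
  omega

/-- In the larger system `y` a push can escape to a walker above `k`, but whenever it moves a walker
that is level with its counterpart in `x`, that counterpart moves as well. -/
theorem drop_afterRing_le {x y : HalfSig} {k i : ℕ} (h : y.drop k ≤ x) (hi : k ≤ i) :
    (afterRing y i).drop k ≤ afterRing x (i - k) := by
  intro j
  change (afterRing y i).1 (j + k) ≤ (afterRing x (i - k)).1 j
  have h0 : ∀ j, y.1 (j + k) ≤ x.1 j := h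
  have h1 := h0 j
  have h2 := h0 (i - k)
  have h3 := h0 (j - 1)
  rw [Nat.sub_add_cancel hi] at h2
  rw [afterRing_apply, afterRing_apply]
  split_ifs with c1 c2 c2
  · omega
  · obtain ⟨c3, c4⟩ := c1
    -- Otherwise `y` overtakes `x` at `j`, so both were level there. The sandwich `x (i - k) ≤ x j =
    -- y (j + k) = y i ≤ x (i - k)` puts `j` in the block of `i - k` in `x`. If `j ≠ 0`, the gap
    -- above `j + k` in `y` forces one above `j` in `x`, so `j` moves in `x` too.
    by_contra hlt
    have h4 : j ≤ i - k := by
      by_contra h5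
      have h6 : y.1 (j + k - 1) ≤ y.1 i := y.2 (by omega)
      omega
    have h5 : x.1 (i - k) ≤ x.1 j := x.2 h4
    refine c2 ⟨by omega, ?_⟩
    by_cases hj : j = 0
    · exact Or.inl hj
    · rw [show j - 1 + k = j + k - 1 by omega] at h3
      omega
  · omega
  · omega

/-- A move from a position at least `d` is invisible after truncation. Below `d`, both the block of
the ringing walker and whether a gap lies above it can be read off the truncated configuration. -/
theorem trunc_drop_afterRing {d : ℤ} {x y : HalfSig} {k i : ℕ}
    (h : (y.drop k).trunc d = x.trunc d) (hd : ∀ j < k, d ≤ y.1 j) (hi : k ≤ i) :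
    ((afterRing y i).drop k).trunc d = (afterRing x (i - k)).trunc d := by
  have h0 : ∀ j, min d (y.1 (j + k)) = min d (x.1 j) := fun j =>
    congrFun (congrArg Subtype.val h) j
  refine Subtype.ext (funext fun j => ?_)
  change min d ((afterRing y i).1 (j + k)) = min d ((afterRing x (i - k)).1 j)
  have h1 := h0 j
  have h2 := h0 (i - k)
  have h3 := h0 (j - 1)
  rw [Nat.sub_add_cancel hi] at h2
  rw [afterRing_apply, afterRing_apply]
  -- Walker `0` of `x` has nobody above it, whereas its counterpart in `y` may have walker `k - 1`
  -- above; that one is at or above `d` and so cannot block a move from below `d`.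
  by_cases hj : j = 0
  · subst hj
    have h4 : k ≠ 0 → d ≤ y.1 (0 + k - 1) := fun hk => hd _ (by omega)
    have h5 : k = 0 ∨ k ≠ 0 := by omega
    split_ifs <;> omega
  · rw [show j - 1 + k = j + k - 1 by omega] at h3
    split_ifs <;> omega

theorem afterRing_congr {x y : HalfSig} {M i : ℕ} (h : ∀ j ≤ M, x.1 j = y.1 j) (hi : i ≤ M) :
    ∀ j ≤ M, (afterRing x i).1 j = (afterRing y i).1 j := by
  intro j hj
  rw [afterRing_apply, afterRing_apply, h j hj, h i hi, h (j - 1) (by omega)]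

/-! ### The effect of a list of rings -/

/-- The rings of a list which concern the walkers `k, k + 1, …`, renumbered from `0`. -/
def shiftRings (k : ℕ) (l : List ℕ) : List ℕ := (l.filter (k ≤ ·)).map (· - k)

theorem shiftRings_cons (k i : ℕ) (l : List ℕ) :
    shiftRings k (i :: l) = if k ≤ i then (i - k) :: shiftRings k l else shiftRings k l := by
  by_cases h : k ≤ i <;> simp [shiftRings, h]

theorem le_foldl_afterRing (l : List ℕ) (x : HalfSig) : x ≤ l.foldl afterRing x := by
  induction l generalizing x with
  | nil => exact le_rfl
  | cons i l ih => exact (le_afterRing x i).trans (ih _)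

theorem drop_foldl_afterRing_le {k : ℕ} (l : List ℕ) {x y : HalfSig} (h : y.drop k ≤ x) :
    (l.foldl afterRing y).drop k ≤ (shiftRings k l).foldl afterRing x := by
  induction l generalizing x y with
  | nil => exact h
  | cons i l ih =>
    rw [shiftRings_cons]
    split_ifs with hi
    · exact ih (drop_afterRing_le h hi)
    · exact ih (by rwa [drop_afterRing_of_lt y (by omega)])

theorem trunc_drop_foldl_afterRing {d : ℤ} {k : ℕ} (l : List ℕ) {x y : HalfSig}
    (h : (y.drop k).trunc d = x.trunc d) (hd : ∀ j < k, d ≤ y.1 j) :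
    ((l.foldl afterRing y).drop k).trunc d = ((shiftRings k l).foldl afterRing x).trunc d := by
  induction l generalizing x y with
  | nil => exact h
  | cons i l ih =>
    have hd' : ∀ j < k, d ≤ (afterRing y i).1 j := fun j hj => (hd j hj).trans (le_afterRing y i j)
    rw [shiftRings_cons]
    split_ifs with hi
    · exact ih (trunc_drop_afterRing h hd hi) hd'
    · exact ih (by rwa [drop_afterRing_of_lt y (by omega)]) hd'

theorem foldl_afterRing_congr {M : ℕ} (l : List ℕ) (hl : ∀ i ∈ l, i ≤ M) {x y : HalfSig}
    (h : ∀ j ≤ M, x.1 j = y.1 j) :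
    ∀ j ≤ M, (l.foldl afterRing x).1 j = (l.foldl afterRing y).1 j := by
  induction l generalizing x y with
  | nil => exact h
  | cons i l ih =>
    exact ih (fun a ha => hl a (List.mem_cons_of_mem _ ha))
      (afterRing_congr h (hl i List.mem_cons_self))

/-! ### Ring lists -/

/-- `L` enumerates the rings up to time `T` in chronological order. -/
def IsRingList (a : ℕ → ℕ → ℝ) (T : ℝ) (L : List (ℝ ×ₗ ℕ)) : Prop :=
  L.Pairwise (· < ·) ∧ ∀ p, p ∈ L ↔ p ∈ rings a T

/-- The numbers of the walkers whose clocks ring. -/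
def ringers (L : List (ℝ ×ₗ ℕ)) : List ℕ := L.map fun p => (ofLex p).2

theorem IsRingList.finite {a : ℕ → ℕ → ℝ} {T : ℝ} {L : List (ℝ ×ₗ ℕ)} (h : IsRingList a T L) :
    (rings a T).Finite :=
  L.finite_toSet.subset fun p hp => (h.2 p).2 hp

theorem exists_isRingList {a : ℕ → ℕ → ℝ} {T : ℝ} (h : (rings a T).Finite) :
    ∃ L, IsRingList a T L :=
  ⟨h.toFinset.sort (· ≤ ·), (Finset.sortedLT_sort _).pairwise, fun p => by simp⟩

theorem IsRingList.walkers_eq {a : ℕ → ℕ → ℝ} {T : ℝ} {L : List (ℝ ×ₗ ℕ)}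
    (h : IsRingList a T L) (ν : HalfSig) :
    walkers ν a T = (ringers L).foldl afterRing ν := by
  classical
  have h1 : h.finite.toFinset = L.toFinset := by
    ext p
    simp [h.2]
  have h2 : L.toFinset.sort (· ≤ ·) = L :=
    (List.toFinset_sort (r := (· ≤ ·)) (h.1.imp ne_of_lt)).2 (h.1.imp le_of_lt)
  rw [walkers, dif_pos h.finite, ringers]
  congr 2
  rw [h1]
  convert h2

theorem walkers_congr {a b : ℕ → ℕ → ℝ} {S T : ℝ} (h : rings a S = rings b T) (ν : HalfSig) :
    walkers ν a S = walkers ν b T := by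
  unfold walkers
  generalize rings a S = R at *
  subst h
  rfl

theorem isRingList_shift {a : ℕ → ℕ → ℝ} {T : ℝ} {L : List (ℝ ×ₗ ℕ)} (h : IsRingList a T L)
    (k : ℕ) :
    ∃ L', IsRingList (fun j => a (j + k)) T L' ∧ ringers L' = shiftRings k (ringers L) := by
  refine ⟨(L.filter fun p => k ≤ (ofLex p).2).map fun p => toLex ((ofLex p).1, (ofLex p).2 - k),
    ⟨?_, fun p => ?_⟩, ?_⟩
  · rw [List.pairwise_map]
    -- Membership is kept because subtracting `k` preserves the strict order only on numbers at
    -- least `k`.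
    refine ((List.Pairwise.and_mem.1 (h.1.filter _))).imp ?_
    rintro p q ⟨hp, hq, hpq⟩
    rw [Prod.Lex.lt_iff] at hpq ⊢
    simp only [List.mem_filter, decide_eq_true_eq] at hp hq
    simp only [ofLex_toLex]
    exact hpq.imp id (And.imp id fun _ => by omega)
  · simp only [List.mem_map, List.mem_filter, decide_eq_true_eq, h.2]
    constructor
    · rintro ⟨q, ⟨⟨h1, m, h2⟩, h3⟩, rfl⟩
      exact ⟨h1, m, by simpa [Nat.sub_add_cancel h3] using h2⟩
    · rintro ⟨h1, m, h2⟩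
      exact ⟨toLex ((ofLex p).1, (ofLex p).2 + k), ⟨⟨h1, m, h2⟩, by simp⟩, by simp⟩
  · simp only [ringers, shiftRings, List.filter_map, List.map_map]
    rfl

theorem isRingList_scale {a : ℕ → ℕ → ℝ} {T c : ℝ} (hc : 0 < c) {L : List (ℝ ×ₗ ℕ)}
    (h : IsRingList a T L) :
    ∃ L', IsRingList (fun i m => c * a i m) (c * T) L' ∧ ringers L' = ringers L := by
  have hr : ∀ i m, ringTime (fun m => c * a i m) m = c * ringTime (a i) m := fun i m => by
    simp [ringTime, Finset.mul_sum]
  refine ⟨L.map fun p => toLex (c * (ofLex p).1, (ofLex p).2), ⟨?_, fun p => ?_⟩, ?_⟩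
  · rw [List.pairwise_map]
    refine h.1.imp ?_
    intro p q hpq
    rw [Prod.Lex.lt_iff] at hpq ⊢
    exact hpq.imp (fun h => mul_lt_mul_of_pos_left h hc) (And.imp (fun h => by
      simp only [ofLex_toLex, h]) id)
  · simp only [List.mem_map, h.2]
    constructor
    · rintro ⟨q, ⟨h1, m, h2⟩, rfl⟩
      exact ⟨mul_le_mul_of_nonneg_left h1 hc.le, m, by simp only [ofLex_toLex, hr, h2]⟩
    · rintro ⟨h1, m, h2⟩
      refine ⟨toLex (ringTime (a (ofLex p).2) m, (ofLex p).2), ⟨?_, m, rfl⟩, ?_⟩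
      · rw [h2, hr] at h1
        exact le_of_mul_le_mul_left h1 hc
      · simp only [ofLex_toLex, ← hr, ← h2]
        rfl
  · simp [ringers]

theorem walkers_scale {a : ℕ → ℕ → ℝ} {T c : ℝ} (hc : 0 < c) (h : (rings a T).Finite)
    (ν : HalfSig) : walkers ν (fun i m => c * a i m) (c * T) = walkers ν a T := by
  obtain ⟨L, hL⟩ := exists_isRingList h
  obtain ⟨L', hL', e⟩ := isRingList_scale hc hL
  rw [hL.walkers_eq, hL'.walkers_eq, e]

theorem le_walkers (a : ℕ → ℕ → ℝ) (T : ℝ) (ν : HalfSig) : ν ≤ walkers ν a T := by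
  by_cases h : (rings a T).Finite
  · obtain ⟨L, hL⟩ := exists_isRingList h
    rw [hL.walkers_eq]
    exact le_foldl_afterRing _ _
  · rw [walkers, dif_neg h]

theorem drop_walkers_le {a : ℕ → ℕ → ℝ} {T : ℝ} (h : (rings a T).Finite) {x y : HalfSig} {k : ℕ}
    (hxy : y.drop k ≤ x) :
    (walkers y a T).drop k ≤ walkers x (fun j => a (j + k)) T := by
  obtain ⟨L, hL⟩ := exists_isRingList h
  obtain ⟨L', hL', e⟩ := isRingList_shift hL k
  rw [hL.walkers_eq, hL'.walkers_eq, e]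
  exact drop_foldl_afterRing_le _ hxy

theorem walkers_mono {a : ℕ → ℕ → ℝ} {T : ℝ} {x y : HalfSig} (hxy : y ≤ x) :
    walkers y a T ≤ walkers x a T := by
  by_cases h : (rings a T).Finite
  · exact drop_walkers_le (k := 0) h hxy
  · rwa [walkers, dif_neg h, walkers, dif_neg h]

theorem trunc_drop_walkers {a : ℕ → ℕ → ℝ} {T : ℝ} (h : (rings a T).Finite) {x y : HalfSig}
    {k : ℕ} {d : ℤ} (hxy : (y.drop k).trunc d = x.trunc d) (hd : ∀ j < k, d ≤ y.1 j) :
    ((walkers y a T).drop k).trunc d = (walkers x (fun j => a (j + k)) T).trunc d := by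
  obtain ⟨L, hL⟩ := exists_isRingList h
  obtain ⟨L', hL', e⟩ := isRingList_shift hL k
  rw [hL.walkers_eq, hL'.walkers_eq, e]
  exact trunc_drop_foldl_afterRing _ hxy hd

theorem trunc_walkers_congr {a : ℕ → ℕ → ℝ} {T : ℝ} {x y : HalfSig} {d : ℤ}
    (hxy : y.trunc d = x.trunc d) : (walkers y a T).trunc d = (walkers x a T).trunc d := by
  by_cases h : (rings a T).Finite
  · exact trunc_drop_walkers (k := 0) h hxy (by simp)
  · rwa [walkers, dif_neg h, walkers, dif_neg h]

/-- A walker depends only on finitely many coordinates of the initial configuration. -/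
theorem exists_walkers_congr (a : ℕ → ℕ → ℝ) (T : ℝ) (j : ℕ) :
    ∃ M, ∀ x y : HalfSig, (∀ i ≤ M, x.1 i = y.1 i) →
      (walkers x a T).1 j = (walkers y a T).1 j := by
  by_cases h : (rings a T).Finite
  · obtain ⟨L, hL⟩ := exists_isRingList h
    refine ⟨(ringers L).foldr max j, fun x y hxy => ?_⟩
    have hj : ∀ l : List ℕ, j ≤ l.foldr max j := fun l => by
      induction l with
      | nil => exact le_rfl
      | cons i l ih => exact ih.trans (le_max_right _ _)
    have hmem : ∀ l : List ℕ, ∀ i ∈ l, i ≤ l.foldr max j := fun l => by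
      induction l with
      | nil => simp
      | cons i l ih =>
        intro b hb
        rcases List.mem_cons.1 hb with rfl | hb
        · exact le_max_left _ _
        · exact (ih b hb).trans (le_max_right _ _)
    rw [hL.walkers_eq, hL.walkers_eq]
    exact foldl_afterRing_congr _ (hmem _) hxy j (hj _)
  · exact ⟨j, fun x y hxy => by rw [walkers, dif_neg h, walkers, dif_neg h]; exact hxy j le_rfl⟩

/-! ### Continuing a clock with another one -/

/-- The waiting times of a clock which rings like the clock `w` up to time `s`, and afterwards like
the clock `w'` started at time `s`. -/
def splice : ℝ → (ℕ → ℝ) → (ℕ → ℝ) → ℕ → ℝ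
  | s, w, w', 0 => if s < w 0 then s + w' 0 else w 0
  | s, w, w', m + 1 => if s < w 0 then w' (m + 1) else splice (s - w 0) (fun l => w (l + 1)) w' m

theorem ringTime_zero (w : ℕ → ℝ) : ringTime w 0 = w 0 := by simp [ringTime]

theorem ringTime_succ' (w : ℕ → ℝ) (m : ℕ) :
    ringTime w (m + 1) = w 0 + ringTime (fun l => w (l + 1)) m := by
  rw [ringTime, Finset.sum_range_succ', ringTime, add_comm]

theorem ringTime_splice_of_lt {s : ℝ} {w w' : ℕ → ℝ} (h : s < w 0) (m : ℕ) :
    ringTime (splice s w w') m = s + ringTime w' m := by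
  cases m with
  | zero => simp [ringTime_zero, splice, h]
  | succ m => simp [ringTime_succ', splice, h, add_assoc]

theorem ringTime_splice_of_le {s : ℝ} {w w' : ℕ → ℝ} (h : w 0 ≤ s) (m : ℕ) :
    ringTime (splice s w w') (m + 1) =
      w 0 + ringTime (splice (s - w 0) (fun l => w (l + 1)) w') m := by
  simp [ringTime_succ', splice, h.not_gt]

theorem le_ringTime {w : ℕ → ℝ} (hw : ∀ l, 0 < w l) (m : ℕ) : w 0 ≤ ringTime w m :=
  Finset.single_le_sum (fun l _ => (hw l).le) (Finset.mem_range.2 m.succ_pos)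

/-- Induction on the number of rings of `w` needed to pass `s`: as long as the first ring comes by
time `s`, it is stripped off and `s` is lowered by the first waiting time. The bound `hN` ensures
that this recursion reaches the switch to `w'`. -/
theorem exists_eq_ringTime_splice_iff {s : ℝ} {w w' : ℕ → ℝ} (hw : ∀ l, 0 < w l) {N : ℕ}
    (hN : s < ringTime w N) (p : ℝ) :
    (∃ m, p = ringTime (splice s w w') m) ↔
      (p ≤ s ∧ ∃ m, p = ringTime w m) ∨ ∃ m, p = s + ringTime w' m := by
  have hlt : ∀ {w : ℕ → ℝ} {s p : ℝ}, (∀ l, 0 < w l) → s < w 0 →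
      ((∃ m, p = ringTime (splice s w w') m) ↔
        (p ≤ s ∧ ∃ m, p = ringTime w m) ∨ ∃ m, p = s + ringTime w' m) := by
    intro w s p hw h
    simp only [ringTime_splice_of_lt h]
    refine ⟨Or.inr, ?_⟩
    rintro (⟨h1, m, h2⟩ | h1)
    · linarith [le_ringTime hw m]
    · exact h1
  induction N generalizing s w p with
  | zero => exact hlt hw (by rwa [ringTime_zero] at hN)
  | succ N ih =>
    by_cases h : s < w 0
    · exact hlt hw h
    · push Not at h
      have ih' := ih (s := s - w 0) (w := fun l => w (l + 1)) (fun l => hw _)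
        (by rw [ringTime_succ'] at hN; linarith) (p - w 0)
      have h1 : (∃ m, p = ringTime (splice s w w') m) ↔
          p = w 0 ∨ ∃ m, p - w 0 = ringTime (splice (s - w 0) (fun l => w (l + 1)) w') m := by
        rw [← Nat.or_exists_add_one]
        simp [ringTime_splice_of_le h, ringTime_zero, splice, h.not_gt, sub_eq_iff_eq_add']
      have h2 : (∃ m, p = ringTime w m) ↔
          p = w 0 ∨ ∃ m, p - w 0 = ringTime (fun l => w (l + 1)) m := by
        rw [← Nat.or_exists_add_one]
        simp [ringTime_succ', ringTime_zero, sub_eq_iff_eq_add']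
      have h3 : ∀ m, p - w 0 = s - w 0 + ringTime w' m ↔ p = s + ringTime w' m := fun m => by
        constructor <;> intro h <;> linarith
      rw [h1, h2, or_congr_right ih']
      simp only [h3, sub_le_sub_iff_right]
      by_cases h4 : p = w 0
      · simp [h4, h]
      · simp [h4]

section

variable {a a' : ℕ → ℕ → ℝ} {s u : ℝ}

theorem mem_rings_splice_iff (ha : ∀ i l, 0 < a i l) (hub : ∀ i, ∃ N, s < ringTime (a i) N)
    (hu : 0 ≤ u) (p : ℝ ×ₗ ℕ) :
    p ∈ rings (fun i => splice s (a i) (a' i)) (s + u) ↔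
      p ∈ rings a s ∨ toLex ((ofLex p).1 - s, (ofLex p).2) ∈ rings a' u := by
  obtain ⟨N, hN⟩ := hub (ofLex p).2
  have h := exists_eq_ringTime_splice_iff (w' := a' (ofLex p).2) (ha _) hN (ofLex p).1
  simp only [rings, Set.mem_ofPred_eq, h, ofLex_toLex, sub_le_iff_le_add', sub_eq_iff_eq_add']
  constructor
  · rintro ⟨h1, h2 | h2⟩
    exacts [Or.inl h2, Or.inr ⟨h1, h2⟩]
  · rintro (h2 | ⟨h1, h2⟩)
    exacts [⟨by linarith [h2.1], Or.inl h2⟩, ⟨h1, Or.inr h2⟩]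

theorem pos_of_mem_rings (ha : ∀ i l, 0 < a i l) {p : ℝ ×ₗ ℕ} (hp : p ∈ rings a s) :
    0 < (ofLex p).1 := by
  obtain ⟨_, m, h⟩ := hp
  rw [h]
  exact (ha _ 0).trans_le (le_ringTime (ha _) m)

theorem rings_splice_of_le (ha : ∀ i l, 0 < a i l) (ha' : ∀ i l, 0 < a' i l)
    (hub : ∀ i, ∃ N, s < ringTime (a i) N) {r : ℝ} (hr : r ≤ s) :
    rings (fun i => splice s (a i) (a' i)) r = rings a r := by
  ext p
  have h1 : ∀ b : ℕ → ℕ → ℝ, p ∈ rings b r ↔ (ofLex p).1 ≤ r ∧ p ∈ rings b s := fun b => by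
    simp only [rings, Set.mem_ofPred_eq]
    exact ⟨fun h => ⟨h.1, h.1.trans hr, h.2⟩, fun h => ⟨h.1, h.2.2⟩⟩
  have h2 := mem_rings_splice_iff (a' := a') ha hub le_rfl p
  rw [add_zero] at h2
  rw [h1, h1 a, h2]
  refine and_congr_right fun h3 => or_iff_left fun h4 => ?_
  have := pos_of_mem_rings ha' h4
  simp only [ofLex_toLex] at this
  linarith

/-- The chronological list of rings of the spliced clocks is the list up to time `s` followed by the
list of `a'` delayed by `s`, and folding over a concatenation composes. Positivity of `a'` separates
the two lists strictly. -/
theorem walkers_splice (ha : ∀ i l, 0 < a i l) (ha' : ∀ i l, 0 < a' i l)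
    (hub : ∀ i, ∃ N, s < ringTime (a i) N) (hu : 0 ≤ u) (hf : (rings a s).Finite)
    (hf' : (rings a' u).Finite) (ν : HalfSig) :
    walkers ν (fun i => splice s (a i) (a' i)) (s + u) = walkers (walkers ν a s) a' u := by
  obtain ⟨L, hL⟩ := exists_isRingList hf
  obtain ⟨L', hL'⟩ := exists_isRingList hf'
  have h : IsRingList (fun i => splice s (a i) (a' i)) (s + u)
      (L ++ L'.map fun p => toLex ((ofLex p).1 + s, (ofLex p).2)) := by
    constructor
    · rw [List.pairwise_append]
      refine ⟨hL.1, ?_, fun p hp q hq => ?_⟩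
      · rw [List.pairwise_map]
        refine hL'.1.imp fun {p q} hpq => ?_
        rw [Prod.Lex.lt_iff] at hpq ⊢
        simpa using hpq
      · obtain ⟨q', hq', rfl⟩ := List.mem_map.1 hq
        rw [Prod.Lex.lt_iff]
        have h1 := pos_of_mem_rings ha' ((hL'.2 q').1 hq')
        have h2 := ((hL.2 p).1 hp).1
        simp only [ofLex_toLex]
        exact Or.inl (by linarith)
    · intro p
      rw [mem_rings_splice_iff ha hub hu, List.mem_append, hL.2, List.mem_map]
      refine or_congr_right ?_
      simp only [hL'.2]
      constructor
      · rintro ⟨q, hq, rfl⟩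
        simpa using hq
      · intro hp
        exact ⟨_, hp, by simp⟩
  rw [h.walkers_eq, hL.walkers_eq, hL'.walkers_eq, ringers, List.map_append, List.foldl_append]
  simp [ringers, Function.comp_def]

end

/-! ### The limit of the half-infinite systems -/

/-- The almost sure properties of the clocks: the waiting times are positive, every clock rings only
finitely often up to any time, and so does the family of clocks `k, k + 1, …`. -/
structure Good (ω : ℤ → ℕ → ℝ) : Prop where
  pos : ∀ i l, 0 < ω i l
  unbounded : ∀ (i : ℤ) (T : ℕ), ∃ N, (T : ℝ) < ringTime (ω i) N
  late : ∀ T : ℕ, ∃ K : ℕ, ∀ k : ℕ, K ≤ k → (T : ℝ) < ω k 0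

theorem ringTime_mono {w : ℕ → ℝ} (hw : ∀ l, 0 < w l) : Monotone (ringTime w) := by
  refine monotone_nat_of_le_succ fun n => ?_
  rw [ringTime, ringTime, Finset.sum_range_succ _ (n + 1)]
  linarith [hw (n + 1)]

theorem Good.exists_lt_ringTime {ω : ℤ → ℕ → ℝ} (h : Good ω) (i : ℤ) (T : ℝ) :
    ∃ N, T < ringTime (ω i) N := by
  obtain ⟨T', hT'⟩ := exists_nat_ge T
  obtain ⟨N, hN⟩ := h.unbounded i T'
  exact ⟨N, hT'.trans_lt hN⟩

theorem Good.finite {ω : ℤ → ℕ → ℝ} (h : Good ω) (n : ℤ) (T : ℝ) :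
    (rings (fun j => ω (n + j)) T).Finite := by
  obtain ⟨T', hT'⟩ := exists_nat_ge T
  obtain ⟨K, hK⟩ := h.late T'
  -- For `i ≥ K + |n|` the index `n + i` is a natural number at least `K`, so that clock has not
  -- rung by time `T`. Finitely many clocks with finitely many rings each remain.
  have h1 : (⋃ i ∈ Finset.range (K + n.natAbs), (fun m => toLex (ringTime (ω (n + i)) m, i)) ''
      {m | ringTime (ω (n + i)) m ≤ T}).Finite := by
    refine Set.Finite.biUnion (Finset.finite_toSet _) fun i _ => Set.Finite.image _ ?_
    obtain ⟨N, hN⟩ := h.exists_lt_ringTime (n + i) T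
    refine (Set.finite_lt_nat N).subset fun m hm => ?_
    by_contra hle
    exact (hN.trans_le (ringTime_mono (h.pos _) (not_lt.1 hle))).not_ge hm
  refine h1.subset fun p => ?_
  rintro ⟨h2, m, h3⟩
  simp only [Set.mem_iUnion, Set.mem_image, Finset.mem_range]
  refine ⟨(ofLex p).2, ?_, m, ?_, ?_⟩
  · by_contra hge
    obtain ⟨k, hk⟩ := Int.eq_ofNat_of_zero_le (a := n + (ofLex p).2) (by omega)
    have h4 := hK k (by omega)
    have h5 := le_ringTime (h.pos (n + (ofLex p).2)) m
    simp only [hk] at h3 h5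
    linarith
  · simpa only [h3, Set.mem_ofPred_eq] using h2
  · simp only [← h3]
    rfl

section

variable {ω ω' : ℤ → ℕ → ℝ} {s u T : ℝ}

/-- The condition `-i ≤ n` makes `(i + n).toNat` the true index of walker `i`, so the systems are
compared after dropping the `k` extra walkers on top. -/
theorem approx_add_le (h : Good ω) (μ : BiSig) {n : ℕ} (k : ℕ) {i : ℤ} (hi : -i ≤ n) :
    approx μ (n + k) ω T i ≤ approx μ n ω T i := by
  have hxy : (μ.tail (-(n + k : ℕ))).drop k ≤ μ.tail (-n) := fun j =>
    le_of_eq (congrArg μ.1 (by push_cast; ring))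
  have h1 := drop_walkers_le (h.finite (-(n + k : ℕ)) T) hxy (i + n).toNat
  have e1 : (i + n).toNat + k = (i + (n + k : ℕ)).toNat := by omega
  have e2 : (fun j : ℕ => ω (-(n + k : ℕ) + (j + k : ℕ))) = fun j : ℕ => ω (-n + j) := by
    ext1 j
    congr 1
    push_cast
    ring
  simp only [HalfSig.drop, e1, e2] at h1
  exact h1

theorem le_approx (ω : ℤ → ℕ → ℝ) (T : ℝ) (μ : BiSig) {n : ℕ} {i : ℤ} (hi : -i ≤ n) :
    μ.1 i ≤ approx μ n ω T i := by
  refine le_trans (le_of_eq (congrArg μ.1 ?_))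
    (le_walkers (fun j => ω (-n + j)) T (μ.tail (-n)) (i + n).toNat)
  omega

/-- The limiting position of walker `i`. -/
def limitPos (μ : BiSig) (ω : ℤ → ℕ → ℝ) (T : ℝ) (i : ℤ) : ℤ :=
  -- The shift by `i.natAbs` leaves out the small systems that do not contain walker `i`.
  ⨅ n : ℕ, approx μ (n + i.natAbs) ω T i

theorem eventually_approx_eq (h : Good ω) (μ : BiSig) (T : ℝ) (i : ℤ) :
    ∀ᶠ n : ℕ in atTop, approx μ n ω T i = limitPos μ ω T i := by
  have hb : BddBelow (Set.range fun n : ℕ => approx μ (n + i.natAbs) ω T i) :=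
    ⟨μ.1 i, by rintro _ ⟨n, rfl⟩; exact le_approx ω T μ (by omega)⟩
  obtain ⟨n₀, h₀⟩ := Int.csInf_mem (Set.range_nonempty _) hb
  filter_upwards [eventually_ge_atTop (n₀ + i.natAbs)] with n hn
  obtain ⟨k, rfl⟩ := Nat.exists_eq_add_of_le hn
  refine le_antisymm ((approx_add_le h μ k (by omega)).trans (le_of_eq h₀)) ?_
  exact (ciInf_le hb (n₀ + k)).trans (le_of_eq (by congr 1; omega))

theorem limitPos_le_approx (h : Good ω) (μ : BiSig) {n : ℕ} {i : ℤ} (hi : -i ≤ n) :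
    limitPos μ ω T i ≤ approx μ n ω T i := by
  obtain ⟨m, h1, h2⟩ := ((eventually_approx_eq h μ T i).and (eventually_ge_atTop n)).exists
  obtain ⟨k, rfl⟩ := Nat.exists_eq_add_of_le h2
  exact h1 ▸ approx_add_le h μ k hi

theorem antitone_limitPos (h : Good ω) (μ : BiSig) (T : ℝ) : Antitone (limitPos μ ω T) := by
  intro i j hij
  obtain ⟨n, h1, h2⟩ :=
    ((eventually_approx_eq h μ T i).and (eventually_approx_eq h μ T j)).exists
  rw [← h1, ← h2]
  exact (walkers _ _ T).2 (by omega)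

open Classical in
/-- The limiting configuration at time `T` of the walkers which start from `μ`. -/
def sea (μ : BiSig) (ω : ℤ → ℕ → ℝ) (T : ℝ) : BiSig :=
  -- The default `μ` makes the starting value and the bound `le_sea` hold for every `ω`, not just
  -- almost surely.
  if h : Good ω then ⟨limitPos μ ω T, antitone_limitPos h μ T⟩ else μ

theorem sea_apply (h : Good ω) (μ : BiSig) (T : ℝ) (i : ℤ) :
    (sea μ ω T).1 i = limitPos μ ω T i := by
  rw [sea, dif_pos h]

theorem eventually_approx_eq_sea (h : Good ω) (μ : BiSig) (T : ℝ) (i : ℤ) :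
    ∀ᶠ n : ℕ in atTop, approx μ n ω T i = (sea μ ω T).1 i := by
  rw [sea_apply h]
  exact eventually_approx_eq h μ T i

theorem sea_le_approx (h : Good ω) (μ : BiSig) {n : ℕ} {i : ℤ} (hi : -i ≤ n) :
    (sea μ ω T).1 i ≤ approx μ n ω T i := by
  rw [sea_apply h]
  exact limitPos_le_approx h μ hi

theorem le_sea (ω : ℤ → ℕ → ℝ) (T : ℝ) (μ : BiSig) : μ ≤ sea μ ω T := by
  intro i
  by_cases h : Good ω
  · obtain ⟨n, h1, h2⟩ :=
      ((eventually_approx_eq_sea h μ T i).and (eventually_ge_atTop i.natAbs)).exists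
    exact (le_approx ω T μ (by omega)).trans h1.le
  · rw [sea, dif_neg h]

theorem sea_zero (μ : BiSig) (ω : ℤ → ℕ → ℝ) : sea μ ω 0 = μ := by
  by_cases h : Good ω
  · refine Subtype.ext (funext fun i => ?_)
    obtain ⟨n, h1, h2⟩ :=
      ((eventually_approx_eq_sea h μ 0 i).and (eventually_ge_atTop i.natAbs)).exists
    have h3 : IsRingList (fun j => ω (-n + j)) 0 [] :=
      ⟨List.Pairwise.nil, fun p => by
        simp only [List.not_mem_nil, false_iff]
        exact fun hp => (pos_of_mem_rings (fun _ => h.pos _) hp).not_ge hp.1⟩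
    rw [← h1, approx, h3.walkers_eq]
    exact congrArg μ.1 (by omega)
  · rw [sea, dif_neg h]

/-! ### Restarting the system -/

/-- All clocks of the family `ω` are continued at time `s` with the clocks of the family `ω'`. -/
def spliceAll (s : ℝ) (ω ω' : ℤ → ℕ → ℝ) : ℤ → ℕ → ℝ := fun i => splice s (ω i) (ω' i)

theorem sea_spliceAll_of_le (h : Good ω) (h' : Good ω') (h'' : Good (spliceAll s ω ω'))
    {r : ℝ} (hr : r ≤ s) (μ : BiSig) : sea μ (spliceAll s ω ω') r = sea μ ω r := by
  refine Subtype.ext (funext fun i => ?_)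
  obtain ⟨n, h1, h2⟩ :=
    ((eventually_approx_eq_sea h μ r i).and (eventually_approx_eq_sea h'' μ r i)).exists
  rw [← h1, ← h2]
  exact congrArg (fun x : HalfSig => x.1 _) (walkers_congr (rings_splice_of_le (fun _ => h.pos _)
    (fun _ => h'.pos _) (fun _ => h.exists_lt_ringTime _ s) hr) _)

/-- For finitely many walkers above this is `walkers_splice`; the point is to pass to the limit in
both phases at once. One inequality uses monotonicity in the initial configuration, the other that a
walker depends on only finitely many initial coordinates. -/
theorem sea_spliceAll (h : Good ω) (h' : Good ω') (h'' : Good (spliceAll s ω ω')) (hu : 0 ≤ u)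
    (μ : BiSig) : sea μ (spliceAll s ω ω') (s + u) = sea (sea μ ω s) ω' u := by
  refine Subtype.ext (funext fun i => ?_)
  set y : BiSig := sea μ ω s with hy
  have key : ∀ n : ℕ, approx μ n (spliceAll s ω ω') (s + u) i =
      (walkers (walkers (μ.tail (-n)) (fun j => ω (-n + j)) s) (fun j => ω' (-n + j)) u).1
        (i + n).toNat := fun n => by
    rw [approx, ← walkers_splice (fun _ => h.pos _) (fun _ => h'.pos _)
      (fun _ => h.exists_lt_ringTime _ s) hu (h.finite _ s) (h'.finite _ u)]
    rfl
  refine le_antisymm ?_ ?_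
  -- Upper bound: choose `m` for which the second phase started from `y` has reached its limit at
  -- `i`, and `M` bounding the coordinates that matter there. For large `n = m + k` the first phase
  -- agrees with `y` on those coordinates, and dropping the `k` extra walkers costs only an
  -- inequality in the right direction.
  · obtain ⟨m, h1, h2⟩ :=
      ((eventually_approx_eq_sea h' y u i).and (eventually_ge_atTop i.natAbs)).exists
    obtain ⟨M, hM⟩ := exists_walkers_congr (fun j => ω' (-m + j)) u (i + m).toNat
    have h3 : ∀ᶠ n : ℕ in atTop, ∀ j ∈ Set.Iic M, approx μ n ω s (-m + j) = y.1 (-m + j) :=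
      ((Set.finite_Iic M).eventually_all).2 fun j _ => eventually_approx_eq_sea h μ s _
    obtain ⟨n, h4, h5⟩ := (h3.and (eventually_ge_atTop m)).exists
    obtain ⟨k, rfl⟩ := Nat.exists_eq_add_of_le h5
    refine (sea_le_approx h'' μ (n := m + k) (by omega)).trans ?_
    rw [key, ← h1, approx]
    set z := walkers (μ.tail (-(m + k : ℕ))) (fun j => ω (-(m + k : ℕ) + j)) s with hz
    have h6 := drop_walkers_le (h'.finite (-(m + k : ℕ)) u) (le_refl (z.drop k)) (i + m).toNat
    have e1 : (i + m).toNat + k = (i + (m + k : ℕ)).toNat := by omega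
    have e2 : (fun j : ℕ => ω' (-(m + k : ℕ) + (j + k : ℕ))) = fun j : ℕ => ω' (-m + j) := by
      ext1 j
      congr 1
      push_cast
      ring
    have h7 : ((walkers z (fun j => ω' (-(m + k : ℕ) + j)) u).drop k).1 (i + m).toNat =
        (walkers z (fun j => ω' (-(m + k : ℕ) + j)) u).1 (i + (m + k : ℕ)).toNat := by
      rw [← e1]
      rfl
    rw [← h7]
    refine le_trans h6 (le_of_eq ?_)
    simp only [e2]
    refine hM _ _ fun j hj => ?_
    have h8 := h4 j hj
    rw [approx, ← hz] at h8
    refine Eq.trans (congrArg z.1 ?_) h8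
    omega
  -- Lower bound: `y` lies below each first-phase approximation, so starting the second phase from
  -- it gives lower positions.
  · obtain ⟨n, h1, h2⟩ := ((eventually_approx_eq_sea h'' μ (s + u) i).and
      (eventually_ge_atTop i.natAbs)).exists
    rw [← h1, key]
    refine (sea_le_approx h' y (n := n) (by omega)).trans ?_
    refine walkers_mono ?_ _
    intro j
    refine (sea_le_approx h μ (n := n) (by omega)).trans (le_of_eq ?_)
    rw [approx]
    exact congrArg _ (by omega)

/-! ### Truncation -/

theorem trunc_sea (h : Good ω) (μ : BiSig) (T : ℝ) (d : ℤ) :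
    (sea (μ.trunc d) ω T).trunc d = (sea μ ω T).trunc d := by
  refine Subtype.ext (funext fun i => ?_)
  obtain ⟨n, h1, h2⟩ := ((eventually_approx_eq_sea h μ T i).and
    (eventually_approx_eq_sea h (μ.trunc d) T i)).exists
  change min d _ = min d _
  rw [← h1, ← h2]
  have h3 : ((μ.trunc d).tail (-n)).trunc d = (μ.tail (-n)).trunc d :=
    Subtype.ext (funext fun j => by simp [BiSig.tail, HalfSig.trunc, BiSig.trunc])
  exact congrFun (congrArg Subtype.val (trunc_walkers_congr h3)) _

/-- The `K = k + 1 + n` walkers of the approximation with index at most `k` start, hence stay, at or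
above `d`. Removing them does not change what is seen below `d`, so no limit is left. -/
theorem tail_trunc_sea (h : Good ω) {μ : BiSig} {d k : ℤ} (hd : d ≤ μ.1 k) (T : ℝ) :
    ((sea μ ω T).trunc d).tail (k + 1) =
      (walkers (μ.tail (k + 1)) (fun j => ω (k + 1 + j)) T).trunc d := by
  refine Subtype.ext (funext fun j => ?_)
  obtain ⟨n, h1, h2⟩ := ((eventually_approx_eq_sea h μ T (k + 1 + j)).and
    (eventually_ge_atTop (k + 1).natAbs)).exists
  obtain ⟨K, hK⟩ := Int.eq_ofNat_of_zero_le (a := k + 1 + n) (by omega)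
  change min d ((sea μ ω T).1 (k + 1 + j)) = min d _
  rw [← h1, approx]
  have hxy : ((μ.tail (-n)).drop K).trunc d = (μ.tail (k + 1)).trunc d :=
    Subtype.ext (funext fun l => congrArg (fun x => min d (μ.1 x)) (by push_cast; omega))
  have h3 := trunc_drop_walkers (h.finite (-n) T) hxy fun l hl =>
    hd.trans (μ.2 (by omega : -(n : ℤ) + l ≤ k))
  have e2 : (fun l : ℕ => ω (-n + (l + K : ℕ))) = fun l : ℕ => ω (k + 1 + l) := by
    ext1 l
    congr 1
    push_cast
    omega
  rw [e2] at h3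
  rw [show (k + 1 + j + n).toNat = j + K by omega]
  exact congrFun (congrArg Subtype.val h3) j

end

/-! ### Measurability -/

theorem measurable_afterRing (i : ℕ) : Measurable fun x : HalfSig => afterRing x i := by
  refine Measurable.subtype_mk (measurable_pi_iff.2 fun j => ?_)
  have h : (fun x : HalfSig => bump x.1 (mover x.1 i) j) = fun x : HalfSig =>
      if x.1 j = x.1 i ∧ (j = 0 ∨ x.1 j < x.1 (j - 1)) then x.1 j + 1 else x.1 j :=
    funext fun x => afterRing_apply x i j
  rw [h]
  have hm : ∀ j, Measurable fun x : HalfSig => x.1 j := fun j =>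
    (measurable_pi_apply j).comp measurable_subtype_coe
  exact Measurable.ite ((measurableSet_eq_fun (hm j) (hm i)).inter
    ((MeasurableSet.const _).union (measurableSet_lt (hm j) (hm _))))
    ((hm j).add measurable_const) (hm j)

theorem measurable_foldl_afterRing (l : List ℕ) :
    Measurable fun x : HalfSig => l.foldl afterRing x := by
  induction l with
  | nil => exact measurable_id
  | cons i l ih => exact ih.comp (measurable_afterRing i)

/-- The `q.2`-th ring of the clock of walker `q.1`. -/
def ringAt (a : ℕ → ℕ → ℝ) (q : ℕ × ℕ) : ℝ ×ₗ ℕ := toLex (ringTime (a q.1) q.2, q.1)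

theorem IsRingList.exists_map_ringAt {a : ℕ → ℕ → ℝ} {T : ℝ} {L : List (ℝ ×ₗ ℕ)}
    (h : IsRingList a T L) : ∃ L' : List (ℕ × ℕ), L'.map (ringAt a) = L := by
  have h1 : L ∈ Set.range (List.map (ringAt a)) := by
    rw [Set.range_list_map]
    intro p hp
    obtain ⟨_, m, h2⟩ := (h.2 p).1 hp
    refine ⟨((ofLex p).2, m), ?_⟩
    simp only [ringAt, ← h2]
    rfl
  exact h1

/-- Rephrases the condition by countably many comparisons of ring times, which makes it a measurable
event for a fixed list of labels. -/
theorem isRingList_map_ringAt_iff (a : ℕ → ℕ → ℝ) (T : ℝ) (L : List (ℕ × ℕ)) :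
    IsRingList a T (L.map (ringAt a)) ↔
      L.Pairwise (fun q q' => ringAt a q < ringAt a q') ∧
      (∀ q ∈ L, ringTime (a q.1) q.2 ≤ T) ∧
      ∀ q : ℕ × ℕ, ringTime (a q.1) q.2 ≤ T → ∃ q' ∈ L, ringAt a q' = ringAt a q := by
  rw [IsRingList, List.pairwise_map]
  refine and_congr_right fun _ => ?_
  simp only [List.mem_map]
  constructor
  · intro h
    exact ⟨fun q hq => ((h _).1 ⟨q, hq, rfl⟩).1, fun q hq => (h _).2 ⟨hq, q.2, rfl⟩⟩
  · rintro ⟨h1, h2⟩ p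
    constructor
    · rintro ⟨q, hq, rfl⟩
      exact ⟨h1 q hq, q.2, rfl⟩
    · rintro ⟨h3, m, h4⟩
      obtain ⟨q', h5, h6⟩ := h2 ((ofLex p).2, m) (by rwa [← h4])
      refine ⟨q', h5, h6.trans ?_⟩
      simp only [ringAt, ← h4]
      rfl

theorem measurable_ringTime (m : ℕ) : Measurable fun w : ℕ → ℝ => ringTime w m :=
  Finset.measurable_sum _ fun l _ => measurable_pi_apply l

section

variable {α : Type*} [MeasurableSpace α] {a : α → ℕ → ℕ → ℝ} {ν : α → HalfSig}

theorem measurableSet_isRingList (ha : Measurable a) (T : ℝ) (L : List (ℕ × ℕ)) :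
    MeasurableSet {x | IsRingList (a x) T (L.map (ringAt (a x)))} := by
  have hr : ∀ q : ℕ × ℕ, Measurable fun x => ringTime (a x q.1) q.2 := fun q =>
    (measurable_ringTime q.2).comp ((measurable_pi_apply q.1).comp ha)
  have hlt : ∀ q q', MeasurableSet {x | ringAt (a x) q < ringAt (a x) q'} := fun q q' => by
    simp only [Prod.Lex.lt_iff, ringAt, ofLex_toLex]
    exact (measurableSet_lt (hr q) (hr q')).union
      ((measurableSet_eq_fun (hr q) (hr q')).inter (MeasurableSet.const _))
  have heq : ∀ q q', MeasurableSet {x | ringAt (a x) q = ringAt (a x) q'} := fun q q' => by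
    simp only [ringAt, EmbeddingLike.apply_eq_iff_eq, Prod.mk.injEq]
    exact (measurableSet_eq_fun (hr q) (hr q')).inter (MeasurableSet.const _)
  have hle : ∀ q : ℕ × ℕ, MeasurableSet {x | ringTime (a x q.1) q.2 ≤ T} := fun q =>
    measurableSet_le (hr q) measurable_const
  have hpw : ∀ L : List (ℕ × ℕ),
      MeasurableSet {x | L.Pairwise fun q q' => ringAt (a x) q < ringAt (a x) q'} := fun L => by
    induction L with
    | nil => simp
    | cons q L ih =>
      simp only [List.pairwise_cons, Set.ofPred_and]
      refine MeasurableSet.inter ?_ ih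
      simp only [Set.ofPred_forall]
      exact MeasurableSet.iInter fun q' => MeasurableSet.iInter fun _ => hlt q q'
  simp only [isRingList_map_ringAt_iff, Set.ofPred_and]
  refine (hpw L).inter (MeasurableSet.inter ?_ ?_)
  · simp only [Set.ofPred_forall]
    exact MeasurableSet.iInter fun q => MeasurableSet.iInter fun _ => hle q
  · rw [Set.ofPred_forall]
    refine MeasurableSet.iInter fun q => MeasurableSet.imp (hle q) ?_
    simp only [Set.ofPred_exists, Set.ofPred_and]
    exact MeasurableSet.iUnion fun q' => (MeasurableSet.const _).inter (heq q' q)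

theorem measurable_walkers (ha : Measurable a) (hν : Measurable ν) (T : ℝ) :
    Measurable fun x => walkers (ν x) (a x) T := by
  intro B hB
  set R : List (ℕ × ℕ) → Set α := fun L => {x | IsRingList (a x) T (L.map (ringAt (a x)))} with hR
  have hRm : ∀ L, MeasurableSet (R L) := measurableSet_isRingList ha T
  -- There are only countably many lists of labels, and on the event that a given one lists the
  -- rings, the configuration is a fixed composition of measurable maps. Off all these events the
  -- default value applies.
  have h : (fun x => walkers (ν x) (a x) T) ⁻¹' B =
      (⋃ L, R L ∩ (fun x => (L.map Prod.fst).foldl afterRing (ν x)) ⁻¹' B) ∪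
        ((⋃ L, R L)ᶜ ∩ ν ⁻¹' B) := by
    ext x
    by_cases hx : (rings (a x) T).Finite
    · have h1 : ∀ L, x ∈ R L →
          walkers (ν x) (a x) T = (L.map Prod.fst).foldl afterRing (ν x) := fun L hL => by
        rw [IsRingList.walkers_eq hL, ringers, List.map_map]
        rfl
      obtain ⟨L₀, h₀⟩ := exists_isRingList hx
      obtain ⟨L, rfl⟩ := h₀.exists_map_ringAt
      simp only [Set.mem_preimage, Set.mem_union, Set.mem_iUnion, Set.mem_inter_iff,
        Set.mem_compl_iff]
      constructor
      · exact fun h2 => Or.inl ⟨L, h₀, h1 L h₀ ▸ h2⟩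
      · rintro (⟨L', h2, h3⟩ | ⟨h2, -⟩)
        · rwa [h1 L' h2]
        · exact absurd ⟨L, h₀⟩ h2
    · have h1 : ∀ L, x ∉ R L := fun L hL => hx (IsRingList.finite hL)
      simp [h1, walkers, hx]
  rw [h]
  exact (MeasurableSet.iUnion fun L => (hRm L).inter
    (((measurable_foldl_afterRing _).comp hν) hB)).union
    ((MeasurableSet.iUnion hRm).compl.inter (hν hB))

end

theorem measurable_coord (i : ℤ) : Measurable fun μ : BiSig => μ.1 i :=
  (measurable_pi_apply i).comp measurable_subtype_coe

theorem measurable_tail (a : ℤ) : Measurable fun μ : BiSig => μ.tail a :=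
  Measurable.subtype_mk (f := fun (μ : BiSig) (i : ℕ) => μ.1 (a + i))
    (measurable_pi_iff.2 fun i => measurable_coord (a + i))

theorem measurable_trunc (d : ℤ) : Measurable (BiSig.trunc d) :=
  Measurable.subtype_mk (measurable_pi_iff.2 fun i => measurable_const.min (measurable_coord i))

theorem measurable_halfTrunc (d : ℤ) : Measurable (HalfSig.trunc d) :=
  Measurable.subtype_mk (f := fun (ν : HalfSig) (i : ℕ) => min d (ν.1 i))
    (measurable_pi_iff.2 fun i =>
    measurable_const.min ((measurable_pi_apply i).comp measurable_subtype_coe))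

theorem measurable_approx (n : ℕ) (T : ℝ) (i : ℤ) :
    Measurable fun p : BiSig × (ℤ → ℕ → ℝ) => approx p.1 n p.2 T i := by
  refine (measurable_pi_apply _).comp (measurable_subtype_coe.comp (measurable_walkers ?_ ?_ T))
  · exact measurable_pi_iff.2 fun j => (measurable_pi_apply _).comp measurable_snd
  · exact (measurable_tail _).comp measurable_fst

theorem measurableSet_good : MeasurableSet {ω | Good ω} := by
  have h : {ω | Good ω} = {ω : ℤ → ℕ → ℝ | (∀ i l, 0 < ω i l) ∧
      (∀ (i : ℤ) (T : ℕ), ∃ N, (T : ℝ) < ringTime (ω i) N) ∧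
      ∀ T : ℕ, ∃ K : ℕ, ∀ k : ℕ, K ≤ k → (T : ℝ) < ω k 0} :=
    Set.ext fun ω => ⟨fun h => ⟨h.1, h.2, h.3⟩, fun h => ⟨h.1, h.2.1, h.2.2⟩⟩
  have hc : ∀ (i : ℤ) (l : ℕ), Measurable fun ω : ℤ → ℕ → ℝ => ω i l := fun i l =>
    (measurable_pi_apply l).comp (measurable_pi_apply i)
  rw [h]
  simp only [Set.ofPred_and, Set.ofPred_forall, Set.ofPred_exists]
  refine MeasurableSet.inter ?_ (MeasurableSet.inter ?_ ?_)
  · exact MeasurableSet.iInter fun i => MeasurableSet.iInter fun l =>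
      measurableSet_lt measurable_const (hc i l)
  · exact MeasurableSet.iInter fun i => MeasurableSet.iInter fun T => MeasurableSet.iUnion fun N =>
      measurableSet_lt measurable_const ((measurable_ringTime N).comp (measurable_pi_apply i))
  · exact MeasurableSet.iInter fun T => MeasurableSet.iUnion fun K => MeasurableSet.iInter fun k =>
      MeasurableSet.iInter fun _ => measurableSet_lt measurable_const (hc k 0)

theorem measurable_sea (T : ℝ) :
    Measurable fun p : BiSig × (ℤ → ℕ → ℝ) => sea p.1 p.2 T := by
  classical
  have h : ∀ i, Measurable fun p : BiSig × (ℤ → ℕ → ℝ) => (sea p.1 p.2 T).1 i := fun i => by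
    have h1 : (fun p : BiSig × (ℤ → ℕ → ℝ) => (sea p.1 p.2 T).1 i) = fun p =>
        if Good p.2 then limitPos p.1 p.2 T i else p.1.1 i := by
      ext p
      by_cases hp : Good p.2
      · rw [sea_apply hp, if_pos hp]
      · rw [sea, dif_neg hp, if_neg hp]
    rw [h1]
    exact Measurable.ite (measurable_snd measurableSet_good)
      (Measurable.iInf fun n => measurable_approx _ T i) ((measurable_coord i).comp measurable_fst)
  exact Measurable.subtype_mk (f := fun p : BiSig × (ℤ → ℕ → ℝ) => (sea p.1 p.2 T).1)
    (measurable_pi_iff.2 h)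

theorem measurable_splice (m : ℕ) :
    Measurable fun p : ℝ × (ℕ → ℝ) × (ℕ → ℝ) => splice p.1 p.2.1 p.2.2 m := by
  have hc : ∀ l, Measurable fun p : ℝ × (ℕ → ℝ) × (ℕ → ℝ) => p.2.1 l := fun l => by fun_prop
  have hc' : ∀ l, Measurable fun p : ℝ × (ℕ → ℝ) × (ℕ → ℝ) => p.2.2 l := fun l => by fun_prop
  have hs : MeasurableSet {p : ℝ × (ℕ → ℝ) × (ℕ → ℝ) | p.1 < p.2.1 0} :=
    measurableSet_lt measurable_fst (hc 0)
  induction m with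
  | zero =>
    simp only [splice]
    exact Measurable.ite hs (measurable_fst.add (hc' 0)) (hc 0)
  | succ m ih =>
    simp only [splice]
    refine Measurable.ite hs (hc' _) (ih.comp (f := fun p : ℝ × (ℕ → ℝ) × (ℕ → ℝ) =>
      ((p.1 - p.2.1 0, (fun l => p.2.1 (l + 1)), p.2.2) : ℝ × (ℕ → ℝ) × (ℕ → ℝ))) ?_)
    fun_prop

theorem measurable_spliceAll (s : ℝ) :
    Measurable fun p : (ℤ → ℕ → ℝ) × (ℤ → ℕ → ℝ) => spliceAll s p.1 p.2 := by
  refine measurable_pi_iff.2 fun i => measurable_pi_iff.2 fun m =>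
    (measurable_splice m).comp (f := fun p : (ℤ → ℕ → ℝ) × (ℤ → ℕ → ℝ) => (s, p.1 i, p.2 i)) ?_
  fun_prop

/-! ### The exponential distribution -/

theorem expMeasure_Iic {r : ℝ} (hr : 0 < r) (x : ℝ) :
    expMeasure r (Set.Iic x) = ENNReal.ofReal (if 0 ≤ x then 1 - Real.exp (-(r * x)) else 0) := by
  have := isProbabilityMeasure_expMeasure hr
  rw [← cdf_expMeasure_eq hr, ofReal_cdf]

theorem expMeasure_Iic_zero {r : ℝ} (hr : 0 < r) : expMeasure r (Set.Iic 0) = 0 := by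
  simp [expMeasure_Iic hr]

theorem expMeasure_Ioi {r : ℝ} (hr : 0 < r) {s : ℝ} (hs : 0 ≤ s) :
    expMeasure r (Set.Ioi s) = ENNReal.ofReal (Real.exp (-(r * s))) := by
  have := isProbabilityMeasure_expMeasure hr
  have h1 : Real.exp (-(r * s)) ≤ 1 := Real.exp_le_one_iff.2 (by nlinarith)
  rw [← Set.compl_Iic, prob_compl_eq_one_sub measurableSet_Iic, expMeasure_Iic hr, if_pos hs,
    ← ENNReal.ofReal_one, ← ENNReal.ofReal_sub _ (by linarith)]
  congr 1
  ring

/-- The exponential distribution is memoryless. -/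
theorem expMeasure_Ioi_inter {r : ℝ} (hr : 0 < r) {s : ℝ} (hs : 0 ≤ s) {A : Set ℝ}
    (hA : MeasurableSet A) :
    expMeasure r (Set.Ioi s ∩ A) =
      expMeasure r (Set.Ioi s) * expMeasure r ((fun x => s + x) ⁻¹' A) := by
  have := isProbabilityMeasure_expMeasure hr
  have hm : Measurable fun x : ℝ => s + x := measurable_const_add s
  have h : (expMeasure r).restrict (Set.Ioi s) =
      expMeasure r (Set.Ioi s) • (expMeasure r).map (fun x => s + x) := by
    have : IsFiniteMeasure (expMeasure r (Set.Ioi s) • (expMeasure r).map (fun x => s + x)) :=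
      Measure.smul_finite _ (measure_ne_top _ _)
    refine Measure.ext_of_Iic _ _ fun x => ?_
    rw [Measure.restrict_apply measurableSet_Iic, Measure.smul_apply,
      Measure.map_apply hm measurableSet_Iic, Set.preimage_const_add_Iic, smul_eq_mul,
      expMeasure_Iic hr, expMeasure_Ioi hr hs, ← ENNReal.ofReal_mul (Real.exp_pos _).le,
      Set.inter_comm, Set.Ioi_inter_Iic]
    have hd : Set.Ioc s x = Set.Iic x \ Set.Iic s := by
      ext y
      simp [and_comm]
    by_cases hx : s ≤ x
    · rw [hd, measure_sdiff (Set.Iic_subset_Iic.2 hx) measurableSet_Iic.nullMeasurableSet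
        (measure_ne_top _ _), expMeasure_Iic hr, expMeasure_Iic hr, if_pos hs,
        if_pos (hs.trans hx), if_pos (sub_nonneg.2 hx), ← ENNReal.ofReal_sub]
      · congr 1
        have : Real.exp (-(r * x)) = Real.exp (-(r * s)) * Real.exp (-(r * (x - s))) := by
          rw [← Real.exp_add]
          congr 1
          ring
        rw [this]
        ring
      · have h1 : Real.exp (-(r * s)) ≤ 1 := Real.exp_le_one_iff.2 (by nlinarith)
        linarith
    · rw [Set.Ioc_eq_empty (by linarith), if_neg (by linarith)]
      simp
  have h2 := congrArg (fun μ => μ A) h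
  simpa only [Measure.restrict_apply hA, Measure.smul_apply, Measure.map_apply hm hA, smul_eq_mul,
    Set.inter_comm A] using h2

theorem map_const_mul_expMeasure {r c : ℝ} (hr : 0 < r) (hc : 0 < c) :
    (expMeasure r).map (fun x => c * x) = expMeasure (r / c) := by
  have := isProbabilityMeasure_expMeasure hr
  have := isProbabilityMeasure_expMeasure (div_pos hr hc)
  have hm : Measurable fun x : ℝ => c * x := measurable_const_mul c
  have := Measure.isProbabilityMeasure_map (μ := expMeasure r) hm.aemeasurable
  refine Measure.ext_of_Iic _ _ fun x => ?_
  have h1 : (fun x => c * x) ⁻¹' Set.Iic x = Set.Iic (x / c) := by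
    ext y
    simp [le_div_iff₀' hc]
  rw [Measure.map_apply hm measurableSet_Iic, h1, expMeasure_Iic hr,
    expMeasure_Iic (div_pos hr hc)]
  have h2 : 0 ≤ x / c ↔ 0 ≤ x := by
    rw [le_div_iff₀ hc, zero_mul]
  simp only [h2, mul_div, div_mul_eq_mul_div]

/-! ### Product measures -/

/-- Any finite set of coordinates lies in an initial segment; the missing coordinates are filled
with `Set.univ`. Initial segments suit the recursion of `splice`. -/
theorem eq_infinitePi_of_range {e ρ : Measure _} [IsProbabilityMeasure e]
    (h : ∀ (n : ℕ) (A : ℕ → Set ℝ), (∀ m, MeasurableSet (A m)) →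
      ρ {w : ℕ → ℝ | ∀ m < n, w m ∈ A m} = ∏ m ∈ Finset.range n, e (A m)) :
    ρ = Measure.infinitePi fun _ : ℕ => e := by
  classical
  refine Measure.eq_infinitePi _ fun s A hA => ?_
  have hs : ∀ m ∈ s, m < s.sup id + 1 := fun m hm =>
    Nat.lt_succ_of_le (Finset.le_sup (f := id) hm)
  have h1 := h (s.sup id + 1) (fun m => if m ∈ s then A m else Set.univ) fun m => by
    split_ifs
    exacts [hA m, MeasurableSet.univ]
  have h2 : {w : ℕ → ℝ | ∀ m < s.sup id + 1, w m ∈ if m ∈ s then A m else Set.univ} =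
      (s : Set ℕ).pi A := by
    ext w
    simp only [Set.mem_ofPred_eq, Set.mem_pi, Finset.mem_coe]
    constructor
    · intro h m hm
      simpa [hm] using h m (hs m hm)
    · intro h m _
      by_cases hm : m ∈ s
      · simpa [hm] using h m hm
      · simp [hm]
  rw [h2] at h1
  rw [h1, ← Finset.prod_subset (fun m hm => Finset.mem_range.2 (hs m hm))]
  · exact Finset.prod_congr rfl fun m hm => by rw [if_pos hm]
  · intro m _ hm
    simp [hm]

theorem infinitePi_range {e : Measure ℝ} [IsProbabilityMeasure e] (n : ℕ) {A : ℕ → Set ℝ}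
    (hA : ∀ m, MeasurableSet (A m)) :
    Measure.infinitePi (fun _ : ℕ => e) {w | ∀ m < n, w m ∈ A m} =
      ∏ m ∈ Finset.range n, e (A m) := by
  rw [← Measure.infinitePi_pi (fun _ : ℕ => e) (fun m _ => hA m)]
  congr 1
  ext w
  simp

/-- The sequence with first term `p.1` and remaining terms `p.2`. -/
def prependSeq (p : ℝ × (ℕ → ℝ)) : ℕ → ℝ
  | 0 => p.1
  | n + 1 => p.2 n

theorem measurable_prependSeq : Measurable prependSeq := by
  refine measurable_pi_iff.2 fun n => ?_
  cases n with
  | zero => exact measurable_fst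
  | succ n => exact (measurable_pi_apply n).comp measurable_snd

theorem measurableSet_range_pi {A : ℕ → Set ℝ} (hA : ∀ m, MeasurableSet (A m)) (n : ℕ) :
    MeasurableSet {w : ℕ → ℝ | ∀ m < n, w m ∈ A m} := by
  simp only [Set.ofPred_forall]
  exact MeasurableSet.iInter fun m => MeasurableSet.iInter fun _ => measurable_pi_apply m (hA m)

theorem map_prependSeq (e : Measure ℝ) [IsProbabilityMeasure e] :
    (e.prod (Measure.infinitePi fun _ : ℕ => e)).map prependSeq =
      Measure.infinitePi fun _ : ℕ => e := by
  refine eq_infinitePi_of_range fun n A hA => ?_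
  rw [Measure.map_apply measurable_prependSeq (measurableSet_range_pi hA n)]
  cases n with
  | zero => simp
  | succ n =>
    have h : prependSeq ⁻¹' {w | ∀ m < n + 1, w m ∈ A m} =
        A 0 ×ˢ {w | ∀ m < n, w m ∈ A (m + 1)} := by
      ext p
      simp only [Set.mem_preimage, Set.mem_ofPred_eq, Set.mem_prod, Nat.forall_lt_succ_left']
      exact Iff.rfl
    rw [h, Measure.prod_prod, infinitePi_range n fun m => hA (m + 1), Finset.prod_range_succ',
      mul_comm]

/-- On a box, Fubini gives a finite product of functions of distinct coordinates of the first
factor. These are independent, so the integral factorizes. -/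
theorem map_prod_infinitePi {ι : Type} {X Y Z : ι → Type} [∀ i, MeasurableSpace (X i)]
    [∀ i, MeasurableSpace (Y i)] [∀ i, MeasurableSpace (Z i)] (μ : ∀ i, Measure (X i))
    (ν : ∀ i, Measure (Y i)) [∀ i, IsProbabilityMeasure (μ i)] [∀ i, IsProbabilityMeasure (ν i)]
    {f : ∀ i, X i × Y i → Z i} (hf : ∀ i, Measurable (f i)) {ρ : ∀ i, Measure (Z i)}
    [∀ i, IsProbabilityMeasure (ρ i)] (h : ∀ i, ((μ i).prod (ν i)).map (f i) = ρ i) :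
    ((Measure.infinitePi μ).prod (Measure.infinitePi ν)).map (fun p i => f i (p.1 i, p.2 i)) =
      Measure.infinitePi ρ := by
  refine Measure.eq_infinitePi _ fun s A hA => ?_
  have hm : Measurable fun (p : (∀ i, X i) × (∀ i, Y i)) i => f i (p.1 i, p.2 i) :=
    measurable_pi_iff.2 fun i => (hf i).comp (by fun_prop)
  have hs : MeasurableSet ((s : Set ι).pi A) := .pi s.countable_toSet fun i _ => hA i
  rw [Measure.map_apply hm hs, Measure.prod_apply (hm hs)]
  have h1 : ∀ x : ∀ i, X i, Measure.infinitePi ν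
      (Prod.mk x ⁻¹' ((fun p i => f i (p.1 i, p.2 i)) ⁻¹' (s : Set ι).pi A)) =
      ∏ i ∈ s, ν i (Prod.mk (x i) ⁻¹' (f i ⁻¹' A i)) := fun x => by
    rw [← Measure.infinitePi_pi ν fun i _ => measurable_prodMk_left (hf i (hA i))]
    congr 1
  have h2 : ∀ i, Measurable fun x => ν i (Prod.mk x ⁻¹' (f i ⁻¹' A i)) := fun i =>
    measurable_measure_prodMk_left (hf i (hA i))
  simp only [h1]
  rw [lintegral_prod_eq_prod_lintegral_of_indepFun s _ (iIndepFun_infinitePi h2)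
    fun i => (h2 i).comp (measurable_pi_apply i)]
  refine Finset.prod_congr rfl fun i _ => ?_
  rw [← h i, Measure.map_apply (hf i) (hA i), Measure.prod_apply (hf i (hA i))]
  exact (measurePreserving_eval_infinitePi μ i).lintegral_comp (h2 i)

/-! ### The law of continued clocks -/

theorem splice_mem_iff_of_lt {s : ℝ} {w w' : ℕ → ℝ} (h : s < w 0) (n : ℕ) (A : ℕ → Set ℝ) :
    (∀ m < n + 1, splice s w w' m ∈ A m) ↔ s + w' 0 ∈ A 0 ∧ ∀ m < n, w' (m + 1) ∈ A (m + 1) := by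
  simp only [Nat.forall_lt_succ_left', splice, h, if_true]

theorem splice_mem_iff_of_le {s : ℝ} {w w' : ℕ → ℝ} (h : w 0 ≤ s) (n : ℕ) (A : ℕ → Set ℝ) :
    (∀ m < n + 1, splice s w w' m ∈ A m) ↔ w 0 ∈ A 0 ∧
      ∀ m < n, splice (s - w 0) (fun l => w (l + 1)) w' m ∈ A (m + 1) := by
  simp only [Nat.forall_lt_succ_left', splice, h.not_gt, if_false]

theorem measurable_splice_prod (s : ℝ) :
    Measurable fun p : (ℕ → ℝ) × (ℕ → ℝ) => splice s p.1 p.2 :=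
  measurable_pi_iff.2 fun m => (measurable_splice m).comp
    (f := fun p : (ℕ → ℝ) × (ℕ → ℝ) => (s, p.1, p.2)) (by fun_prop)

/-- Conditioning on the first waiting time `x` gives an induction on the number of coordinates. If
`x > s`, the spliced clock starts with `s + w' 0`, which by memorylessness has the conditional law
of `x`, and continues with `w'`. If `x ≤ s`, it starts with `x` and continues with a splice at the
remaining time `s - x`. -/
theorem map_splice {r : ℝ} (hr : 0 < r) {s : ℝ} (hs : 0 ≤ s) [IsProbabilityMeasure (expMeasure r)] :
    ((Measure.infinitePi fun _ : ℕ => expMeasure r).prod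
      (Measure.infinitePi fun _ : ℕ => expMeasure r)).map (fun p => splice s p.1 p.2) =
      Measure.infinitePi fun _ : ℕ => expMeasure r := by
  refine eq_infinitePi_of_range fun n A hA => ?_
  rw [Measure.map_apply (measurable_splice_prod s) (measurableSet_range_pi hA n)]
  induction n generalizing s A with
  | zero => simp
  | succ n ih =>
    set e := expMeasure r with he
    set ν := Measure.infinitePi fun _ : ℕ => e with hν
    set Q := ∏ m ∈ Finset.range n, e (A (m + 1)) with hQ
    set D := (fun p : (ℕ → ℝ) × (ℕ → ℝ) => splice s p.1 p.2) ⁻¹' {w | ∀ m < n + 1, w m ∈ A m}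
      with hD
    have hDm : MeasurableSet D := measurable_splice_prod s (measurableSet_range_pi hA (n + 1))
    have hmp : Measurable fun q : ℝ × (ℕ → ℝ) × (ℕ → ℝ) => (prependSeq (q.1, q.2.1), q.2.2) :=
      (measurable_prependSeq.comp (by fun_prop)).prodMk (by fun_prop)
    have hν' : ∀ g : (ℕ → ℝ) → ENNReal, Measurable g →
        ∫⁻ w, g w ∂ν = ∫⁻ x, ∫⁻ v, g (prependSeq (x, v)) ∂ν ∂e := fun g hg => by
      calc ∫⁻ w, g w ∂ν = ∫⁻ w, g w ∂(e.prod ν).map prependSeq := by rw [hν, map_prependSeq e]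
        _ = ∫⁻ p, g (prependSeq p) ∂e.prod ν := lintegral_map hg measurable_prependSeq
        _ = _ := lintegral_prod _ (hg.comp measurable_prependSeq).aemeasurable
    have h1 : (ν.prod ν) D = ∫⁻ x, (ν.prod ν) {q | (prependSeq (x, q.1), q.2) ∈ D} ∂e := by
      rw [Measure.prod_apply hDm, hν' _ (measurable_measure_prodMk_left hDm)]
      refine lintegral_congr fun x => ?_
      have hx : MeasurableSet {q : (ℕ → ℝ) × (ℕ → ℝ) | (prependSeq (x, q.1), q.2) ∈ D} :=
        (hmp.comp measurable_prodMk_left) hDm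
      rw [Measure.prod_apply hx]
      rfl
    -- In both cases the later coordinates contribute the same factor `Q`. Integrating the bracket
    -- over `x` gives `e (Set.Ioi s ∩ A 0) + e (Set.Iic s ∩ A 0) = e (A 0)`.
    have h2 : ∀ x, (ν.prod ν) {q | (prependSeq (x, q.1), q.2) ∈ D} =
        ((Set.Ioi s).indicator (fun _ => e ((fun y => s + y) ⁻¹' A 0)) x +
          (Set.Iic s ∩ A 0).indicator 1 x) * Q := fun x => by
      by_cases hx : s < x
      · have h3 : {q : (ℕ → ℝ) × (ℕ → ℝ) | (prependSeq (x, q.1), q.2) ∈ D} = Set.univ ×ˢ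
            {w | ∀ m < n + 1, w m ∈ (fun m => Nat.casesOn m ((fun y => s + y) ⁻¹' A 0)
              fun m => A (m + 1) : ℕ → Set ℝ) m} := by
          ext q
          simp only [hD, Set.mem_preimage, Set.mem_ofPred_eq, Set.mem_prod, Set.mem_univ, true_and]
          rw [splice_mem_iff_of_lt (w := prependSeq (x, q.1)) hx]
          simp only [Nat.forall_lt_succ_left']
          rfl
        have hA' : ∀ m, MeasurableSet ((fun m => Nat.casesOn m ((fun y => s + y) ⁻¹' A 0)
              fun m => A (m + 1) : ℕ → Set ℝ) m) := fun m => by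
          cases m with
          | zero => exact measurable_const_add s (hA 0)
          | succ m => exact hA (m + 1)
        rw [h3, Measure.prod_prod, measure_univ, one_mul, infinitePi_range (n + 1) hA',
          Finset.prod_range_succ', mul_comm]
        simp [hx, hQ]
      · have h3 : {q : (ℕ → ℝ) × (ℕ → ℝ) | (prependSeq (x, q.1), q.2) ∈ D} =
            {q | x ∈ A 0 ∧ q ∈ (fun p : (ℕ → ℝ) × (ℕ → ℝ) => splice (s - x) p.1 p.2) ⁻¹'
              {w | ∀ m < n, w m ∈ A (m + 1)}} := by
          ext q
          simp only [hD, Set.mem_preimage, Set.mem_ofPred_eq]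
          rw [splice_mem_iff_of_le (w := prependSeq (x, q.1)) (not_lt.1 hx)]
          rfl
        rw [h3]
        by_cases hxA : x ∈ A 0
        · have h4 := ih (sub_nonneg.2 (not_lt.1 hx)) (fun m => A (m + 1)) fun m => hA (m + 1)
          simp only [hxA, true_and, Set.ofPred_mem_eq]
          rw [h4]
          simp [hx, hxA, not_lt.1 hx, hQ]
        · simp [hxA, hx]
    have hi := (measurableSet_Iic (a := s)).inter (hA 0)
    have hj : Measurable fun x => (Set.Ioi s).indicator
        (fun _ => e ((fun y => s + y) ⁻¹' A 0)) x + (Set.Iic s ∩ A 0).indicator 1 x :=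
      (measurable_const.indicator measurableSet_Ioi).add (measurable_one.indicator hi)
    rw [h1, lintegral_congr h2, lintegral_mul_const _ hj,
      lintegral_add_right _ (measurable_one.indicator hi),
      lintegral_indicator_const measurableSet_Ioi, lintegral_indicator_one hi, mul_comm (e _),
      ← expMeasure_Ioi_inter hr hs (hA 0), Finset.prod_range_succ', mul_comm]
    congr 1
    have h5 : (Set.Ioi s ∩ A 0) = A 0 \ Set.Iic s := by
      ext y
      simp [and_comm]
    rw [h5, Set.inter_comm, add_comm, measure_inter_add_sdiff _ measurableSet_Iic]

theorem map_spliceAll (r : ℤ → Set.Ioi (0 : ℝ)) {s : ℝ} (hs : 0 ≤ s) :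
    ((clockLaw r).prod (clockLaw r)).map (fun p => spliceAll s p.1 p.2) = clockLaw r :=
  map_prod_infinitePi _ _ (fun _ => measurable_splice_prod s) fun i => map_splice (r i).2 hs

/-! ### The clocks are almost surely good -/

instance {ι : Type} (r : ι → Set.Ioi (0 : ℝ)) : IsProbabilityMeasure (clockLaw r) :=
  inferInstanceAs (IsProbabilityMeasure (Measure.infinitePi _))

instance (t : ℝ) (ht : 0 < t) : IsProbabilityMeasure (biClockLaw t ht) :=
  inferInstanceAs (IsProbabilityMeasure (clockLaw _))

theorem measurePreserving_clock {ι : Type} (r : ι → Set.Ioi (0 : ℝ)) (i : ι) :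
    MeasurePreserving (fun ω : ι → ℕ → ℝ => ω i) (clockLaw r)
      (Measure.infinitePi fun _ : ℕ => expMeasure (r i : ℝ)) :=
  measurePreserving_eval_infinitePi
    (fun i => Measure.infinitePi fun _ : ℕ => expMeasure (r i : ℝ)) i

theorem measurePreserving_waitingTime {ι : Type} (r : ι → Set.Ioi (0 : ℝ)) (i : ι) (l : ℕ) :
    MeasurePreserving (fun ω : ι → ℕ → ℝ => ω i l) (clockLaw r) (expMeasure (r i : ℝ)) :=
  (measurePreserving_eval_infinitePi (fun _ : ℕ => expMeasure (r i : ℝ)) l).comp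
    (measurePreserving_clock r i)

/-- The first `n` waiting times are all at most `T` with probability `p ^ n`, where `p < 1`. -/
theorem ae_unbounded {r : ℝ} (hr : 0 < r) [IsProbabilityMeasure (expMeasure r)] {T : ℝ}
    (hT : 0 ≤ T) :
    ∀ᵐ w ∂Measure.infinitePi fun _ : ℕ => expMeasure r, ∃ l, T < w l := by
  have h1 : expMeasure r (Set.Iic T) < 1 := by
    rw [expMeasure_Iic hr, if_pos hT, ENNReal.ofReal_lt_one]
    linarith [Real.exp_pos (-(r * T))]
  rw [ae_iff]
  push Not
  refine le_antisymm (ge_of_tendsto' (ENNReal.tendsto_pow_atTop_nhds_zero_of_lt_one h1)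
    fun n => ?_) zero_le
  have h2 := infinitePi_range (e := expMeasure r) n (A := fun _ => Set.Iic T)
    fun _ => measurableSet_Iic
  rw [Finset.prod_const, Finset.card_range] at h2
  rw [← h2]
  exact measure_mono fun w hw m _ => hw m

theorem ae_good {t : ℝ} (ht : 0 < t) (ht1 : t < 1) : ∀ᵐ ω ∂biClockLaw t ht, Good ω := by
  obtain ⟨r, hr⟩ : ∃ r : ℤ → Set.Ioi (0 : ℝ), r = fun i => ⟨t ^ i, zpow_pos ht i⟩ := ⟨_, rfl⟩
  rw [biClockLaw, ← hr]
  have h1 : ∀ᵐ ω ∂clockLaw r, ∀ i l, 0 < ω i l := by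
    rw [ae_all_iff]
    intro i
    rw [ae_all_iff]
    intro l
    have h : ∀ᵐ x ∂expMeasure (r i : ℝ), 0 < x := by
      rw [ae_iff]
      simp only [not_lt]
      exact expMeasure_Iic_zero (r i).2
    exact (measurePreserving_waitingTime r i l).quasiMeasurePreserving.ae h
  have h2 : ∀ᵐ ω ∂clockLaw r, ∀ (i : ℤ) (T : ℕ), ∃ l, (T : ℝ) < ω i l := by
    rw [ae_all_iff]
    intro i
    rw [ae_all_iff]
    intro T
    exact (measurePreserving_clock r i).quasiMeasurePreserving.ae
      (ae_unbounded (r i).2 T.cast_nonneg)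
  have h3 : ∀ᵐ ω ∂clockLaw r, ∀ T : ℕ, ∃ K : ℕ, ∀ k : ℕ, K ≤ k → (T : ℝ) < ω k 0 := by
    rw [ae_all_iff]
    intro T
    -- Borel–Cantelli: clock `k` rings by time `T` with probability `1 - exp (-t ^ k * T) ≤ t ^ k *
    -- T`, which is summable because `t < 1`.
    have hs : ∑' k : ℕ, clockLaw r {ω | ω k 0 ≤ T} ≠ ⊤ := by
      have hsum : Summable fun k : ℕ => t ^ k * (T : ℝ) :=
        (summable_geometric_of_lt_one ht.le ht1).mul_right _
      refine ne_top_of_le_ne_top (hsum.tsum_ofReal_ne_top) (ENNReal.tsum_le_tsum fun k => ?_)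
      have h4 := (measurePreserving_waitingTime r k 0).measure_preimage
        (measurableSet_Iic (a := (T : ℝ))).nullMeasurableSet
      refine h4.le.trans ?_
      rw [expMeasure_Iic (r k).2, if_pos T.cast_nonneg, hr]
      simp only [zpow_natCast]
      refine ENNReal.ofReal_le_ofReal ?_
      linarith [Real.add_one_le_exp (-(t ^ k * (T : ℝ)))]
    filter_upwards [ae_eventually_notMem hs] with ω hω
    obtain ⟨K, hK⟩ := eventually_atTop.1 hω
    exact ⟨K, fun k hk => not_le.1 (hK k hk)⟩
  filter_upwards [h1, h2, h3] with ω g1 g2 g3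
  refine ⟨g1, fun i T => ?_, g3⟩
  obtain ⟨l, hl⟩ := g2 i T
  exact ⟨l, hl.trans_le (Finset.single_le_sum (fun m _ => (g1 i m).le)
    (Finset.mem_range.2 l.lt_succ_self))⟩

/-! ### Markov processes from stochastic flows -/

section Flow

variable {Ω E : Type} [MeasurableSpace Ω] [MeasurableSpace E]

/-- A random flow `F` on `E` driven by `P`, where `G s` restarts the randomness at time `s`: the
flow driven by `G s (ω, ω')` follows `ω` up to time `s` and then `ω'`. -/
structure IsRestartableFlow (P : Measure Ω) (F : ℝ≥0 → E → Ω → E) (G : ℝ≥0 → Ω × Ω → Ω) :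
    Prop where
  measurable_flow : ∀ u, Measurable fun p : E × Ω => F u p.1 p.2
  measurable_restart : ∀ s, Measurable (G s)
  map_restart : ∀ s, (P.prod P).map (G s) = P
  flow_zero : ∀ x ω, F 0 x ω = x
  flow_add : ∀ s u, ∀ᵐ p ∂P.prod P, ∀ x, F (s + u) x (G s p) = F u (F s x p.1) p.2
  flow_of_le : ∀ r s, r ≤ s → ∀ᵐ p ∂P.prod P, ∀ x, F r x (G s p) = F r x p.1

/-- The sets which `g` almost surely does not separate from the first component. -/
abbrev aeInvariant (Q : Measure (Ω × Ω)) (g : Ω × Ω → Ω) : MeasurableSpace Ω where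
  MeasurableSet' B := ∀ᵐ p ∂Q, g p ∈ B ↔ p.1 ∈ B
  measurableSet_empty := by simp
  measurableSet_compl B hB := by
    filter_upwards [hB] with p hp
    simp [hp]
  measurableSet_iUnion B hB := by
    filter_upwards [ae_all_iff.2 hB] with p hp
    simp [hp]

/-- The unseparated sets form a σ-algebra containing the generators of the past, so the past as a
whole is unaffected by the restart. -/
theorem ae_restart_mem_iff {P : Measure Ω} {X : ℝ≥0 → Ω → E} {s : ℝ≥0} {g : Ω × Ω → Ω}
    (hX : ∀ r ≤ s, ∀ᵐ p ∂P.prod P, X r (g p) = X r p.1) {B : Set Ω}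
    (hB : MeasurableSet[past X s] B) : ∀ᵐ p ∂P.prod P, g p ∈ B ↔ p.1 ∈ B := by
  have hle : past X s ≤ aeInvariant (P.prod P) g := by
    refine iSup₂_le fun r hr => ?_
    rintro _ ⟨A, -, rfl⟩
    change ∀ᵐ p ∂P.prod P, _
    filter_upwards [hX r hr] with p hp
    simp [hp]
  exact hle B hB

variable (P : Measure Ω) (F : ℝ≥0 → E → Ω → E)

/-- The transition kernels of a random flow. -/
def flowKernel [SFinite P] (u : ℝ≥0) : Kernel E E :=
  (Kernel.id ×ₖ Kernel.const E P).map fun p : E × Ω => F u p.1 p.2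

variable {P F} {G : ℝ≥0 → Ω × Ω → Ω}

theorem IsRestartableFlow.measurable_flow_apply (h : IsRestartableFlow P F G) (u : ℝ≥0) (x : E) :
    Measurable (F u x) := (h.measurable_flow u).comp measurable_prodMk_left

variable [IsProbabilityMeasure P]

theorem IsRestartableFlow.flowKernel_apply (h : IsRestartableFlow P F G) (u : ℝ≥0) (x : E) :
    flowKernel P F u x = P.map (F u x) := by
  rw [flowKernel, Kernel.map_apply _ (h.measurable_flow u), Kernel.prod_apply, Kernel.id_apply,
    Kernel.const_apply, Measure.dirac_prod,
    Measure.map_map (h.measurable_flow u) measurable_prodMk_left]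
  rfl

theorem IsRestartableFlow.flowKernel_apply' (h : IsRestartableFlow P F G) (u : ℝ≥0) (x : E)
    {A : Set E} (hA : MeasurableSet A) : flowKernel P F u x A = P {ω | F u x ω ∈ A} := by
  rw [h.flowKernel_apply, Measure.map_apply (h.measurable_flow_apply u x) hA]
  rfl

theorem IsRestartableFlow.isMarkovKernel (h : IsRestartableFlow P F G) (u : ℝ≥0) :
    IsMarkovKernel (flowKernel P F u) :=
  ⟨fun x => by
    rw [h.flowKernel_apply]
    exact Measure.isProbabilityMeasure_map (h.measurable_flow_apply u x).aemeasurable⟩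

/-- The integrated Markov property. Since `G s` preserves the law, the event may be evaluated at `G
s p`; there `B` depends only on the first component and the flow restarts with the independent
second one, so Fubini gives the kernel. -/
theorem IsRestartableFlow.measure_inter (h : IsRestartableFlow P F G) (s u : ℝ≥0) (x : E)
    {B : Set Ω} (hBm : MeasurableSet B) (hB : ∀ᵐ p ∂P.prod P, G s p ∈ B ↔ p.1 ∈ B) {A : Set E}
    (hA : MeasurableSet A) :
    P (B ∩ F (s + u) x ⁻¹' A) = ∫⁻ ω in B, flowKernel P F u (F s x ω) A ∂P := by
  have hm := h.measurable_flow_apply (s + u) x hA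
  have hm2 : MeasurableSet {p : Ω × Ω | p.1 ∈ B ∧ F u (F s x p.1) p.2 ∈ A} := by
    refine (measurable_fst hBm).inter (MeasurableSet.preimage hA ?_)
    exact (h.measurable_flow u).comp
      (((h.measurable_flow_apply s x).comp measurable_fst).prodMk measurable_snd)
  have h1 : G s ⁻¹' (B ∩ F (s + u) x ⁻¹' A) =ᵐ[P.prod P]
      {p : Ω × Ω | p.1 ∈ B ∧ F u (F s x p.1) p.2 ∈ A} := by
    rw [eventuallyEq_set]
    filter_upwards [hB, h.flow_add s u] with p hp hp'
    simp [hp, hp' x]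
  nth_rw 1 [← h.map_restart s]
  rw [Measure.map_apply (h.measurable_restart s) (hBm.inter hm), measure_congr h1,
    Measure.prod_apply hm2, ← lintegral_indicator hBm]
  refine lintegral_congr fun ω => ?_
  by_cases hω : ω ∈ B
  · rw [Set.indicator_of_mem hω, h.flowKernel_apply' _ _ hA]
    simp [hω]
  · simp [hω]

theorem IsRestartableFlow.flowKernel_add (h : IsRestartableFlow P F G) (s u : ℝ≥0) :
    flowKernel P F (s + u) = flowKernel P F u ∘ₖ flowKernel P F s := by
  refine Kernel.ext fun x => Measure.ext fun A hA => ?_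
  rw [Kernel.comp_apply' _ _ _ hA, h.flowKernel_apply s,
    lintegral_map (Kernel.measurable_coe _ hA) (h.measurable_flow_apply s x),
    h.flowKernel_apply' _ _ hA]
  have h1 := h.measure_inter s u x MeasurableSet.univ (by simp) hA
  rw [Set.univ_inter, Measure.restrict_univ] at h1
  exact h1

variable {f : E → E}

open Classical in
/-- The transition kernels of the image of a random flow under `f`, where the points which `f` moves
are absorbing. -/
def imageKernel (hfix : MeasurableSet {x | f x = x}) (κ : ℝ≥0 → Kernel E E) (u : ℝ≥0) :
    Kernel E E :=
  Kernel.piecewise hfix ((κ u).map f) Kernel.id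

theorem imageKernel_of_eq (hf : Measurable f) (hfix : MeasurableSet {x | f x = x})
    (κ : ℝ≥0 → Kernel E E) (u : ℝ≥0) {x : E} (hx : f x = x) {A : Set E} (hA : MeasurableSet A) :
    imageKernel hfix κ u x A = κ u x (f ⁻¹' A) := by
  classical
  rw [imageKernel, Kernel.piecewise_apply, if_pos (show x ∈ {x | f x = x} from hx),
    Kernel.map_apply' _ hf _ hA]

theorem imageKernel_of_ne (hfix : MeasurableSet {x | f x = x})
    (κ : ℝ≥0 → Kernel E E) (u : ℝ≥0) {x : E} (hx : f x ≠ x) :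
    imageKernel hfix κ u x = Measure.dirac x := by
  classical
  rw [imageKernel, Kernel.piecewise_apply, if_neg (show x ∉ {x | f x = x} from hx), Kernel.id_apply]

/-- Since `f` of the flow depends only on `f` of its start, the image kernel from `f x` is the image
of the flow kernel from `x`, and the semigroup law descends. The image never leaves the fixed points
of `f`; absorption elsewhere only makes the law hold at every point of `E`. -/
theorem IsRestartableFlow.isTransitionSemigroup_imageKernel (h : IsRestartableFlow P F G)
    (hf : Measurable f) (hfix : MeasurableSet {x | f x = x}) (hff : ∀ x, f (f x) = f x)
    (hfF : ∀ u, ∀ᵐ ω ∂P, ∀ x, f (F u (f x) ω) = f (F u x ω)) :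
    IsTransitionSemigroup (imageKernel hfix (flowKernel P F)) ∧
      ∀ u x A, MeasurableSet A →
        imageKernel hfix (flowKernel P F) u (f x) A = flowKernel P F u x (f ⁻¹' A) := by
  have key : ∀ u x A, MeasurableSet A →
      imageKernel hfix (flowKernel P F) u (f x) A = flowKernel P F u x (f ⁻¹' A) := by
    intro u x A hA
    rw [imageKernel_of_eq hf hfix _ u (hff x) hA, h.flowKernel_apply' _ _ (hf hA),
      h.flowKernel_apply' _ _ (hf hA)]
    refine measure_congr ?_
    rw [eventuallyEq_set]
    filter_upwards [hfF u] with ω hω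
    simp [hω x]
  refine ⟨⟨fun s => ?_, ?_, fun s u => ?_⟩, key⟩
  · have := h.isMarkovKernel s
    have := Kernel.IsMarkovKernel.map (flowKernel P F s) hf
    rw [imageKernel]
    infer_instance
  · refine Kernel.ext fun x => Measure.ext fun A hA => ?_
    by_cases hx : f x = x
    · rw [imageKernel_of_eq hf hfix _ _ hx hA, h.flowKernel_apply' _ _ (hf hA), Kernel.id_apply,
        Measure.dirac_apply' _ hA]
      simp only [h.flow_zero, Set.mem_preimage, hx]
      by_cases hxA : x ∈ A <;> simp [hxA]
    · rw [imageKernel_of_ne hfix _ _ hx, Kernel.id_apply]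
  · refine Kernel.ext fun x => Measure.ext fun A hA => ?_
    rw [Kernel.comp_apply' _ _ _ hA]
    by_cases hx : f x = x
    · have h1 : imageKernel hfix (flowKernel P F) s x = (flowKernel P F s x).map f :=
        Measure.ext fun B hB => by
          rw [imageKernel_of_eq hf hfix _ _ hx hB, Measure.map_apply hf hB]
      rw [h1, lintegral_map (Kernel.measurable_coe _ hA) hf, imageKernel_of_eq hf hfix _ _ hx hA,
        h.flowKernel_add, Kernel.comp_apply' _ _ _ (hf hA)]
      exact lintegral_congr fun y => (key u y A hA).symm
    · rw [imageKernel_of_ne hfix _ s hx, lintegral_dirac' _ (Kernel.measurable_coe _ hA),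
        imageKernel_of_ne hfix _ _ hx, imageKernel_of_ne hfix _ _ hx]

/-- The image of a restartable flow under an idempotent map `f`, such that the image of the flow
depends only on the image of its starting point, is a Markov process. -/
theorem IsRestartableFlow.isMarkovProcess (h : IsRestartableFlow P F G)
    (hf : Measurable f) (hfix : MeasurableSet {x | f x = x}) (hff : ∀ x, f (f x) = f x)
    (hfF : ∀ u, ∀ᵐ ω ∂P, ∀ x, f (F u (f x) ω) = f (F u x ω)) (x : E) :
    IsMarkovProcess P fun s ω => f (F s x ω) := by
  obtain ⟨hκ, key⟩ := h.isTransitionSemigroup_imageKernel hf hfix hff hfF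
  have hX : ∀ s, Measurable fun ω => f (F s x ω) := fun s => hf.comp (h.measurable_flow_apply s x)
  refine ⟨hX, imageKernel hfix (flowKernel P F), hκ, fun s u A hA => ?_⟩
  set X : ℝ≥0 → Ω → E := fun s ω => f (F s x ω) with hXdef
  set κ := imageKernel hfix (flowKernel P F) with hκdef
  have hm : past X s ≤ ‹MeasurableSpace Ω› := iSup₂_le fun r _ => (hX r).comap_le
  have hXs : Measurable[past X s] (X s) := by
    intro C hC
    exact (le_iSup₂_of_le (f := fun (r : ℝ≥0) (_ : r ≤ s) =>
      MeasurableSpace.comap (X r) inferInstance) s le_rfl le_rfl) _ ⟨C, hC, rfl⟩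
  have hreal : Measurable fun y => (κ u y).real A := (Kernel.measurable_coe _ hA).ennreal_toReal
  have := hκ.isMarkovKernel
  have hpre : MeasurableSet (X (s + u) ⁻¹' A) := hX (s + u) hA
  have hint : Integrable (fun ω => (κ u (X s ω)).real A) P := by
    refine Integrable.of_bound (hreal.comp (hX s)).aestronglyMeasurable 1
      (Eventually.of_forall fun ω => ?_)
    rw [Real.norm_of_nonneg measureReal_nonneg]
    exact measureReal_le_one
  -- The candidate is measurable with respect to the past, so it remains to compare integrals over
  -- events `B` of the past; this is `measure_inter` applied to `f ⁻¹' A`.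
  refine (ae_eq_condExp_of_forall_setIntegral_eq hm ((integrable_const (1 : ℝ)).indicator hpre)
    (fun _ _ _ => hint.integrableOn) (fun B hB _ => ?_)
    (hreal.comp hXs).stronglyMeasurable.aestronglyMeasurable).symm
  have hBm := hm B hB
  have hBG : ∀ᵐ p ∂P.prod P, G s p ∈ B ↔ p.1 ∈ B := by
    refine ae_restart_mem_iff (X := X) (fun r hr => ?_) hB
    filter_upwards [h.flow_of_le r s hr] with p hp
    simp only [hXdef, hp x]
  change _ = ∫ ω in B, (X (s + u) ⁻¹' A).indicator 1 ω ∂P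
  rw [integral_indicator_one hpre, measureReal_restrict_apply hpre, Set.inter_comm]
  simp only [measureReal_def]
  have hmeas : Measurable fun ω => κ u (X s ω) A := (Kernel.measurable_coe _ hA).comp (hX s)
  rw [integral_toReal hmeas.aemeasurable
    (Eventually.of_forall fun ω => measure_lt_top _ _)]
  congr 1
  refine Eq.trans ?_ (h.measure_inter s u x hBm hBG (hf hA)).symm
  exact lintegral_congr fun ω => key u _ A hA

end Flow

/-! ### The main theorem -/

theorem isRestartableFlow_sea {t : ℝ} (ht : 0 < t) (ht1 : t < 1) :
    IsRestartableFlow (biClockLaw t ht) (fun (u : ℝ≥0) μ ω => sea μ ω u)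
      fun s p => spliceAll s p.1 p.2 := by
  have hae : ∀ s : ℝ≥0, ∀ᵐ p ∂(biClockLaw t ht).prod (biClockLaw t ht),
      Good p.1 ∧ Good p.2 ∧ Good (spliceAll s p.1 p.2) := fun s => by
    have h1 := Measure.quasiMeasurePreserving_fst (μ := biClockLaw t ht)
      (ν := biClockLaw t ht) |>.ae (ae_good ht ht1)
    have h2 := Measure.quasiMeasurePreserving_snd (μ := biClockLaw t ht)
      (ν := biClockLaw t ht) |>.ae (ae_good ht ht1)
    have h3 : MeasurePreserving (fun p : (ℤ → ℕ → ℝ) × (ℤ → ℕ → ℝ) => spliceAll s p.1 p.2)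
        ((biClockLaw t ht).prod (biClockLaw t ht)) (biClockLaw t ht) :=
      ⟨measurable_spliceAll s, map_spliceAll _ s.2⟩
    filter_upwards [h1, h2, h3.quasiMeasurePreserving.ae (ae_good ht ht1)] with p g1 g2 g3
    exact ⟨g1, g2, g3⟩
  exact
    { measurable_flow := fun u => measurable_sea u
      measurable_restart := fun s => measurable_spliceAll s
      map_restart := fun s => map_spliceAll _ s.2
      flow_zero := fun μ ω => sea_zero μ ω
      flow_add := fun s u => by
        filter_upwards [hae s] with p hp μ
        rw [NNReal.coe_add]
        exact sea_spliceAll hp.1 hp.2.1 hp.2.2 u.2 μ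
      flow_of_le := fun r s hrs => by
        filter_upwards [hae s] with p hp μ
        exact sea_spliceAll_of_le hp.1 hp.2.1 hp.2.2 (NNReal.coe_le_coe.2 hrs) μ }

/-- The clocks `k + 1, k + 2, …` with time sped up by `t ^ k` are the clocks of the half-infinite
system. -/
theorem measurePreserving_rescale {t : ℝ} (ht : 0 < t) (k : ℤ) :
    MeasurePreserving (fun (ω : ℤ → ℕ → ℝ) (j m : ℕ) => t ^ k * ω (k + 1 + j) m)
      (biClockLaw t ht) (halfClockLaw t ht) := by
  refine ⟨by fun_prop, ?_⟩
  have hc : Measurable fun (w : ℕ → ℝ) m => t ^ k * w m := by fun_prop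
  have hinj : Function.Injective fun j : ℕ => k + 1 + (j : ℤ) := fun i j h => by simpa using h
  obtain ⟨r, hr⟩ : ∃ r : ℤ → Set.Ioi (0 : ℝ), r = fun i => ⟨t ^ i, zpow_pos ht i⟩ := ⟨_, rfl⟩
  obtain ⟨q, hq⟩ : ∃ q : ℕ → Set.Ioi (0 : ℝ), q = fun i => ⟨t ^ (i + 1), pow_pos ht (i + 1)⟩ :=
    ⟨_, rfl⟩
  rw [biClockLaw, halfClockLaw, ← hr, ← hq]
  have h1 : (clockLaw r).map (fun ω (j : ℕ) => ω (k + 1 + j)) =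
      clockLaw fun j : ℕ => r (k + 1 + j) :=
    Measure.map_infinitePi_infinitePi_of_inj (f := fun j : ℕ => k + 1 + (j : ℤ)) hinj
  have h2 : ∀ j : ℕ, (Measure.infinitePi fun _ : ℕ => expMeasure (r (k + 1 + j) : ℝ)).map
      (fun w m => t ^ k * w m) = Measure.infinitePi fun _ : ℕ => expMeasure (q j : ℝ) := fun j => by
    rw [Measure.infinitePi_map_pi (fun _ : ℕ => expMeasure (r (k + 1 + j) : ℝ))
      (f := fun _ x => t ^ k * x) fun _ => measurable_const_mul _]
    congr 1
    ext1 m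
    -- Scaling waiting times by `t ^ k` divides rates by it: `t ^ (k + 1 + j) / t ^ k = t ^ (j +
    -- 1)`.
    rw [map_const_mul_expMeasure (r _).2 (zpow_pos ht k), hr, hq]
    congr 1
    simp only
    rw [← zpow_sub₀ ht.ne', ← zpow_natCast]
    congr 1
    push_cast
    ring
  have h3 : (clockLaw fun j : ℕ => r (k + 1 + j)).map (fun a j m => t ^ k * a j m) =
      clockLaw q := by
    rw [clockLaw, Measure.infinitePi_map_pi
      (fun j : ℕ => Measure.infinitePi fun _ : ℕ => expMeasure (r (k + 1 + j) : ℝ))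
      (f := fun _ w m => t ^ k * w m) fun _ => hc, clockLaw]
    congr 1
    ext1 j
    exact h2 j
  rw [← h3, ← h1, Measure.map_map (by fun_prop) (by fun_prop)]
  rfl

theorem identDistrib_tail_trunc_sea {t : ℝ} (ht : 0 < t) (ht1 : t < 1) {μ : BiSig} {d k : ℤ}
    (hd : d ≤ μ.1 k) (m : ℕ) (τ : Fin m → ℝ≥0) :
    IdentDistrib
      (fun (ω : ℤ → ℕ → ℝ) (j : Fin m) => ((sea μ ω (τ j)).trunc d).tail (k + 1))
      (fun (a : ℕ → ℕ → ℝ) (j : Fin m) =>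
        (walkers (μ.tail (k + 1)) a (t ^ k * τ j)).trunc d)
      (biClockLaw t ht) (halfClockLaw t ht) := by
  have hS : Measurable fun (ω : ℤ → ℕ → ℝ) (j : Fin m) =>
      ((sea μ ω (τ j)).trunc d).tail (k + 1) :=
    measurable_pi_iff.2 fun j => (measurable_tail _).comp ((measurable_trunc d).comp
      ((measurable_sea (τ j)).comp measurable_prodMk_left))
  have hW : Measurable fun (a : ℕ → ℕ → ℝ) (j : Fin m) =>
      (walkers (μ.tail (k + 1)) a (t ^ k * τ j)).trunc d :=
    measurable_pi_iff.2 fun j => (measurable_halfTrunc d).comp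
      (measurable_walkers measurable_id measurable_const _)
  have hρ := measurePreserving_rescale ht k
  refine ⟨hS.aemeasurable, hW.aemeasurable, ?_⟩
  rw [← hρ.map_eq, Measure.map_map hW hρ.measurable]
  refine Measure.map_congr ?_
  filter_upwards [ae_good ht ht1] with ω hω
  ext1 j
  rw [tail_trunc_sea hω hd, Function.comp_apply,
    walkers_scale (zpow_pos ht k) (hω.finite (k + 1) (τ j))]

end PoissonSea

end

open PoissonSea
theorem theorem1p1 (t : ℝ) (ht0 : 0 < t) (ht1 : t < 1) (μ : BiSig) :
    ∃ S : ℝ≥0 → (ℤ → ℕ → ℝ) → BiSig,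
      -- `S` is the decreasing limit of the coupled half-infinite walker systems
      (∀ᵐ ω ∂biClockLaw t ht0, ∀ (T : ℝ≥0) (i : ℤ),
        (∀ n : ℕ, -i ≤ n → approx μ (n + 1) ω T i ≤ approx μ n ω T i) ∧
        Tendsto (fun n : ℕ => approx μ n ω T i) atTop (𝓝 ((S T ω).1 i))) ∧
      (∀ ω, S 0 ω = μ) ∧
      IsMarkovProcess (biClockLaw t ht0) S ∧
      (∀ d : ℤ, IsMarkovProcess (biClockLaw t ht0) fun T ω => (S T ω).trunc d) ∧
      ∀ d k : ℤ, d ≤ μ.1 k →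
        (∀ᵐ ω ∂biClockLaw t ht0, ∀ (T : ℝ≥0) (i : ℤ), i ≤ k → ((S T ω).trunc d).1 i = d) ∧
        ∀ (m : ℕ) (τ : Fin m → ℝ≥0),
          IdentDistrib
            (fun (ω : ℤ → ℕ → ℝ) (j : Fin m) => ((S (τ j) ω).trunc d).tail (k + 1))
            (fun (a : ℕ → ℕ → ℝ) (j : Fin m) =>
              (walkers (μ.tail (k + 1)) a (t ^ k * τ j)).trunc d)
            (biClockLaw t ht0) (halfClockLaw t ht0) := by
  have hflow := isRestartableFlow_sea ht0 ht1
  refine ⟨fun T ω => sea μ ω T, ?_, fun ω => sea_zero μ ω, ?_, fun d => ?_, fun d k hd =>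
    ⟨Eventually.of_forall fun ω T i hi => ?_, identDistrib_tail_trunc_sea ht0 ht1 hd⟩⟩
  · filter_upwards [ae_good ht0 ht1] with ω hω T i
    exact ⟨fun n hn => approx_add_le hω μ 1 hn,
      tendsto_const_nhds.congr' ((eventually_approx_eq_sea hω μ T i).mono fun n hn => hn.symm)⟩
  · exact hflow.isMarkovProcess (f := id) measurable_id (by simp) (fun _ => rfl)
      (fun _ => Eventually.of_forall fun _ _ => rfl) μ
  · refine hflow.isMarkovProcess (f := BiSig.trunc d) (measurable_trunc d) ?_
      (fun x => Subtype.ext (funext fun i => ?_)) (fun u => ?_) μ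
    · have h : {x : BiSig | x.trunc d = x} = ⋂ i, {x : BiSig | min d (x.1 i) = x.1 i} := by
        ext x
        simp only [Set.mem_iInter, Set.mem_ofPred_eq, Subtype.ext_iff, funext_iff]
        rfl
      rw [h]
      exact MeasurableSet.iInter fun i =>
        measurableSet_eq_fun (measurable_const.min (measurable_coord i)) (measurable_coord i)
    · simp [BiSig.trunc]
    · filter_upwards [ae_good ht0 ht1] with ω hω x
      exact trunc_sea hω x u d
  · exact min_eq_left ((hd.trans (μ.2 hi)).trans (le_sea ω T μ i))
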